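/- Let $\beta>1$ be real. The greedy $\beta$-expansion of a real $x\ge 0$ is the unique representation $x=\sum_{i\le k}x_i\beta^i$ with digits $x_i\in\mathbb Z$, $0\le x_i<\beta$, such that $\sum_{i\le j}x_i\beta^i<\beta^{j+1}$ for every $j\le k$. Let $\mathbb Z_\beta$ be the set of $\beta$-integers, i.e. of real $x$ such that the greedy $\beta$-expansion of $|x|$ has $x_i=0$ for all $i<0$. The $\beta$-continued fraction expansion of $\xi\in\mathbb R$ is produced by $\xi_0=\xi$, $a_n=\max\{y\in\mathbb Z_\beta: y\le \xi_n\}$, $\xi_{n+1}=1/(\xi_n-a_n)$; it stops, and the expansion $[a_0,\dots,a_n]$ is finite, as soon as $\xi_n\in\mathbb Z_\beta$; otherwise it is the infinite expansion $[a_0,a_1,\dots]$. We say that $\beta$ has property (CFF) if every element of $\mathbb Q(\beta)$ has a finite $\beta$-continued fraction expansion. A quadratic Perron number is an algebraic integer $\beta>1$ of degree $2$ over $\mathbb Q$ whose other conjugate $\beta'$ satisfies $|\beta'|<\beta$. **Corollary.** The quadratic Perron numbers smaller than $3$ are exactly $$\tfrac{1+\sqrt5}{2},\quad 1+\sqrt2,\quad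 \tfrac{1+\sqrt{13}}{2},\quad \tfrac{1+\sqrt{17}}{2},\quad \tfrac{3+\sqrt5}{2},\quad 1+\sqrt3,\quad \tfrac{1+\sqrt{21}}{2}.$$ Exactly the first four of them have property (CFF). The last three fail it: for $\beta=\frac{3+\sqrt5}{2}$, $\beta=1+\sqrt3$, $\beta=\frac{1+\sqrt{21}}{2}$, respectively, the following elements of $\mathbb Q(\beta)$ have the indicated infinite, purely periodic $\beta$-continued fraction expansions, which converge to them: $$\tfrac{1+\sqrt5}{2}=[\overline{1}],\qquad \tfrac{11055+10864\sqrt3}{18471}=[\overline{1,1,1,1,1,1,1,2,1,1,2,1,2,1,1,1,2,2}],\qquad \tfrac{117+44\sqrt{21}}{202}=[\overline{1,1,1,2,1,2,1,2,2,2,1,1,2,2}].$$ Moreover, assume Mercat's conjecture: every real quadratic field contains the value of a periodic continued fraction all of whose partial quotients are equal to $1$ or $2$. Then $$\tfrac{1+\sqrt5}{2},\quad 1+\sqrt2,\quad \tfrac{1+\sqrt{13}}{2},\quad \tfrac{1+\sqrt{17}}{2}$$ are exactly the quadratic Perron numbers (of any size) with property (CFF). -/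

import Mathlib

open Filter Topology

/-- `d` is the digit sequence of the greedy expansion `x = ∑_{i ≤ k} d i * β ^ i` of `x ≥ 0` in base
`β > 1`: the digits are integers with `0 ≤ d i < β`, they vanish for all large `i`, and every tail
satisfies `∑_{i ≤ j} d i * β ^ i < β ^ (j + 1)`. -/
structure IsGreedyExpansion (β x : ℝ) (d : ℤ → ℕ) : Prop where
  digit_lt : ∀ i, (d i : ℝ) < β
  leading : ∃ k : ℤ, ∀ i, k < i → d i = 0
  hasSum : HasSum (fun i : ℤ => (d i : ℝ) * β ^ i) x
  greedy : ∀ j : ℤ, ∑' i : Set.Iic j, (d i : ℝ) * β ^ (i : ℤ) < β ^ (j + 1)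

/-- The set `ℤ_β` of `β`-integers: the greedy expansion of `|x|` uses only non-negative powers. -/
def betaIntegers (β : ℝ) : Set ℝ :=
  {x | ∃ d : ℤ → ℕ, IsGreedyExpansion β |x| d ∧ ∀ i < 0, d i = 0}

/-- The `M`-integral part `max {y ∈ M | y ≤ ξ}`. (For `M = ℤ_β` with `β > 1`, the set is non-empty
and its maximum exists, hence equals the supremum.) -/
noncomputable def mFloor (M : Set ℝ) (ξ : ℝ) : ℝ := sSup {y | y ∈ M ∧ y ≤ ξ}

/-- The complete quotients `ξ₀ = ξ`, `ξ_{n+1} = 1 / (ξ_n - ⌊ξ_n⌋_M)`. The algorithm stops at the first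
`n` with `ξ_n ∈ M`; the values after that index carry no meaning. -/
noncomputable def completeQuotient (M : Set ℝ) (ξ : ℝ) : ℕ → ℝ
  | 0 => ξ
  | n + 1 => 1 / (completeQuotient M ξ n - mFloor M (completeQuotient M ξ n))

/-- The `M`-continued fraction expansion of `ξ` is finite: some complete quotient lies in `M`. -/
def HasFiniteExpansion (M : Set ℝ) (ξ : ℝ) : Prop :=
  ∃ n, completeQuotient M ξ n ∈ M

/-- The `M`-continued fraction algorithm applied to `ξ` never stops and produces the infinite sequence
of partial quotients `a`. -/
def HasInfiniteExpansion (M : Set ℝ) (ξ : ℝ) (a : ℕ → ℝ) : Prop :=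
  ∀ n, completeQuotient M ξ n ∉ M ∧ a n = mFloor M (completeQuotient M ξ n)

/-- Property (CFF): every element of `ℚ(β)` has a finite `β`-continued fraction expansion. -/
def CFF (β : ℝ) : Prop :=
  ∀ ξ ∈ IntermediateField.adjoin ℚ ({β} : Set ℝ), HasFiniteExpansion (betaIntegers β) ξ

/-- Numerators of the convergents, with index shifted by one: `cfNum a n = p_{n-1}`. -/
def cfNum (a : ℕ → ℝ) : ℕ → ℝ
  | 0 => 1
  | 1 => a 0
  | n + 2 => a (n + 1) * cfNum a (n + 1) + cfNum a n

/-- Denominators of the convergents, with index shifted by one: `cfDen a n = q_{n-1}`. -/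
def cfDen (a : ℕ → ℝ) : ℕ → ℝ
  | 0 => 0
  | 1 => 1
  | n + 2 => a (n + 1) * cfDen a (n + 1) + cfDen a n

/-- `[a 0, a 1, a 2, …] = ξ`: the convergents `p_n / q_n` tend to `ξ`. -/
def CFConvergesTo (a : ℕ → ℝ) (ξ : ℝ) : Prop :=
  Tendsto (fun n => cfNum a (n + 1) / cfDen a (n + 1)) atTop (𝓝 ξ)

/-- The purely periodic sequence obtained by repeating the non-empty list `l`. -/
def repeatList (l : List ℕ) (n : ℕ) : ℝ := (l.getD (n % l.length) 0 : ℕ)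

/-- Perron numbers: real algebraic integers `β > 1` all of whose other conjugates `z ∈ ℂ` satisfy
`|z| < β`. -/
def IsPerron (β : ℝ) : Prop :=
  1 < β ∧ IsIntegral ℤ β ∧ ∀ z ∈ (minpoly ℚ β).aroots ℂ, z ≠ (β : ℂ) → ‖z‖ < β

/-- Perron numbers of degree two over `ℚ`. -/
def IsQuadraticPerron (β : ℝ) : Prop :=
  IsPerron β ∧ (minpoly ℚ β).natDegree = 2

/-- Mercat's conjecture: every real quadratic field contains (the value of) a periodic continued
fraction all of whose partial quotients are equal to 1 or 2. -/
def MercatConjecture : Prop :=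
  ∀ K : IntermediateField ℚ ℝ, Module.finrank ℚ K = 2 →
    ∃ ξ ∈ K, ∃ a : ℕ → ℕ, (∀ n, a n = 1 ∨ a n = 2) ∧ (∃ p, 0 < p ∧ Function.Periodic a p) ∧
      CFConvergesTo (fun n => (a n : ℝ)) ξ

/-- `ξ ∈ ℚ(β)`, `ξ` is the value of the periodic continued fraction with period `l`, and this continued
fraction is the `β`-continued fraction expansion of `ξ`. -/
def IsPeriodicBetaCF (β ξ : ℝ) (l : List ℕ) : Prop :=
  ξ ∈ IntermediateField.adjoin ℚ ({β} : Set ℝ) ∧ CFConvergesTo (repeatList l) ξ ∧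
    HasInfiniteExpansion (betaIntegers β) ξ (repeatList l)

/-- Digit sequences all of whose partial sums are greedy yield `β`-integers. -/
theorem sum_digits_mem_betaIntegers {β : ℝ} (hβ : 1 < β) {d : ℕ → ℕ} {k : ℕ}
    (hd : ∀ i, k ≤ i → d i = 0)
    (hg : ∀ j, ∑ i ∈ Finset.range j, (d i : ℝ) * β ^ i < β ^ j) :
    ∑ i ∈ Finset.range k, (d i : ℝ) * β ^ i ∈ betaIntegers β := by
  have hβ0 : 0 < β := by linarith
  have hnn : 0 ≤ ∑ i ∈ Finset.range k, (d i : ℝ) * β ^ i :=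
    Finset.sum_nonneg fun i _ => by positivity
  set D : ℤ → ℕ := fun i => if 0 ≤ i then d i.toNat else 0 with hD
  have hDn : ∀ n : ℕ, D n = d n := fun n => by simp [hD]
  refine ⟨D, ⟨?_, ⟨k, ?_⟩, ?_, ?_⟩, ?_⟩
  · intro i
    by_cases hi : 0 ≤ i
    · lift i to ℕ using hi
      rw [hDn]
      have h := hg (i + 1)
      rw [Finset.sum_range_succ, pow_succ] at h
      have h0 : 0 ≤ ∑ i ∈ Finset.range i, (d i : ℝ) * β ^ i :=
        Finset.sum_nonneg fun i _ => by positivity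
      have hp : 0 < β ^ i := by positivity
      by_contra! hc
      nlinarith
    · simp [hD, hi, hβ0]
  · intro i hi
    lift i to ℕ using by omega
    rw [hDn]
    exact hd i (by omega)
  · rw [abs_of_nonneg hnn]
    have h := hasSum_sum_of_ne_finset_zero (f := fun i : ℤ => (D i : ℝ) * β ^ i)
      (s := (Finset.range k).map Nat.castEmbedding) (L := SummationFilter.unconditional ℤ) ?_
    · rw [Finset.sum_map] at h
      simpa [hDn] using h
    · intro i hi
      by_cases h0 : 0 ≤ i
      · lift i to ℕ using h0
        rw [hDn, hd i (by simpa using hi)]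
        simp
      · simp [hD, h0]
  · intro j
    have hpos : 0 < β ^ (j + 1) := by positivity
    rw [tsum_subtype (Set.Iic j) (fun i : ℤ => (D i : ℝ) * β ^ i)]
    by_cases hj : 0 ≤ j
    · lift j to ℕ using hj
      rw [tsum_eq_sum (s := (Finset.range (j + 1)).map Nat.castEmbedding)]
      · rw [Finset.sum_map]
        refine lt_of_eq_of_lt (Finset.sum_congr rfl fun i hi => ?_) (by exact_mod_cast hg (j + 1))
        have : i ≤ j := by simpa [Nat.lt_succ_iff] using hi
        simp [Set.indicator, this, hDn]
      · intro i hi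
        by_cases h0 : 0 ≤ i
        · lift i to ℕ using h0
          have : ¬ i ≤ j := by simpa [Nat.lt_succ_iff] using hi
          simp [Set.indicator, this]
        · simp [Set.indicator, hD, h0]
    · have : ∀ i : ℤ, (Set.Iic j).indicator (fun i : ℤ => (D i : ℝ) * β ^ i) i = 0 := by
        intro i
        by_cases hij : i ≤ j
        · have : ¬ 0 ≤ i := by omega
          simp [Set.indicator, hD, this]
        · simp [Set.indicator, hij]
      simpa [this] using hpos
  · intro i hi
    simp [hD, not_le.2 hi]

/-- A `β`-integer is, up to sign, a finite sum of non-negative powers of `β`. -/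
theorem exists_digits_of_mem_betaIntegers {β z : ℝ} (hz : z ∈ betaIntegers β) :
    ∃ (k : ℕ) (d : ℕ → ℕ), (∀ i, (d i : ℝ) < β) ∧
      |z| = ∑ i ∈ Finset.range k, (d i : ℝ) * β ^ i := by
  obtain ⟨D, ⟨hlt, ⟨k, hk⟩, hs, -⟩, hneg⟩ := hz
  refine ⟨k.toNat + 1, fun i => D i, fun i => hlt i, ?_⟩
  have h := hasSum_sum_of_ne_finset_zero (f := fun i : ℤ => (D i : ℝ) * β ^ i)
    (s := (Finset.range (k.toNat + 1)).map Nat.castEmbedding)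
    (L := SummationFilter.unconditional ℤ) ?_
  · rw [Finset.sum_map] at h
    simpa using hs.unique h
  · intro i hi
    by_cases h0 : 0 ≤ i
    · lift i to ℕ using h0
      have : k.toNat + 1 ≤ i := by simpa using hi
      simp [hk i (by omega)]
    · simp [hneg i (by omega)]

theorem neg_mem_betaIntegers {β z : ℝ} (hz : z ∈ betaIntegers β) : -z ∈ betaIntegers β := by
  simpa [betaIntegers] using hz

theorem pow_mem_betaIntegers {β : ℝ} (hβ : 1 < β) (k : ℕ) : β ^ k ∈ betaIntegers β := by
  have h := sum_digits_mem_betaIntegers hβ (d := fun i => if i = k then 1 else 0) (k := k + 1)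
    (fun i hi => if_neg (by omega)) ?_
  · simpa using h
  · intro j
    by_cases hj : k < j
    · simpa [hj] using pow_lt_pow_right₀ hβ hj
    · have : 0 < β ^ j := by positivity
      simpa [hj] using this

theorem natCast_mem_betaIntegers {β : ℝ} (hβ : 1 < β) {n : ℕ} (hn : (n : ℝ) < β) :
    (n : ℝ) ∈ betaIntegers β := by
  have h := sum_digits_mem_betaIntegers hβ (d := fun i => if i = 0 then n else 0) (k := 1)
    (fun i hi => if_neg (by omega)) ?_
  · simpa using h
  · intro j
    rcases Nat.eq_zero_or_pos j with rfl | hj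
    · simp
    · have : β ≤ β ^ j := le_self_pow₀ hβ.le (by omega)
      simpa [hj] using hn.trans_le this

theorem exists_natCast_of_mem_betaIntegers {β z : ℝ} (hβ : 1 < β) (hz : z ∈ betaIntegers β)
    (h0 : 0 ≤ z) (hlt : z < β) : ∃ n : ℕ, z = n := by
  obtain ⟨k, d, -, hs⟩ := exists_digits_of_mem_betaIntegers hz
  rw [abs_of_nonneg h0] at hs
  rcases Nat.eq_zero_or_pos k with rfl | hk
  · exact ⟨0, by simpa using hs⟩
  · refine ⟨d 0, ?_⟩
    rw [hs, Finset.sum_eq_single_of_mem 0 (by simpa using hk)]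
    · simp
    · intro i hi hi0
      have hle : (d i : ℝ) * β ^ i ≤ z := by
        rw [hs]
        exact Finset.single_le_sum (f := fun i => (d i : ℝ) * β ^ i)
          (fun i _ => by positivity) hi
      have hp : β ≤ β ^ i := le_self_pow₀ hβ.le hi0
      have hd : d i = 0 := by
        by_contra hd
        have : (1 : ℝ) ≤ d i := by exact_mod_cast Nat.one_le_iff_ne_zero.2 hd
        nlinarith
      simp [hd]

/-- Below `β` the `β`-integral part is the usual integral part. -/
theorem mFloor_betaIntegers_of_lt {β ξ : ℝ} (hβ : 1 < β) {n : ℕ} (hn : (n : ℝ) ≤ ξ)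
    (hn' : ξ < n + 1) (hlt : ξ < β) : mFloor (betaIntegers β) ξ = n := by
  have : IsGreatest {y | y ∈ betaIntegers β ∧ y ≤ ξ} (n : ℝ) := by
    refine ⟨⟨natCast_mem_betaIntegers hβ (hn.trans_lt hlt), hn⟩, ?_⟩
    rintro y ⟨hy, hyξ⟩
    by_contra! hc
    obtain ⟨m, rfl⟩ := exists_natCast_of_mem_betaIntegers hβ hy
      ((Nat.cast_nonneg n).trans hc.le) (hyξ.trans_lt hlt)
    have h1 : n < m := by exact_mod_cast hc
    have h2 : (m : ℝ) < (n + 1 : ℕ) := by push_cast; exact hyξ.trans_lt hn'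
    have h3 : m < n + 1 := by exact_mod_cast h2
    omega
  exact this.csSup_eq

theorem notMem_betaIntegers_of_lt {β ξ : ℝ} (hβ : 1 < β) {n : ℕ} (hn : (n : ℝ) < ξ)
    (hn' : ξ < n + 1) (hlt : ξ < β) : ξ ∉ betaIntegers β := by
  intro h
  obtain ⟨m, rfl⟩ := exists_natCast_of_mem_betaIntegers hβ h
      ((Nat.cast_nonneg n).trans hn.le) hlt
  have h1 : n < m := by exact_mod_cast hn
  have h3 : m < n + 1 := by exact_mod_cast hn'
  omega

theorem exists_greedy_digits {β : ℝ} (hβ : 1 < β) (k : ℕ) :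
    ∀ ξ : ℝ, 0 ≤ ξ → ξ < β ^ k → ∃ d : ℕ → ℕ, (∀ i, k ≤ i → d i = 0) ∧
      (∀ j, ∑ i ∈ Finset.range j, (d i : ℝ) * β ^ i < β ^ j) ∧
      ∑ i ∈ Finset.range k, (d i : ℝ) * β ^ i ≤ ξ ∧
      ξ < ∑ i ∈ Finset.range k, (d i : ℝ) * β ^ i + 1 := by
  induction k with
  | zero =>
    intro ξ h0 h1
    refine ⟨fun _ => 0, fun _ _ => rfl, fun j => ?_, ?_, ?_⟩
    · have : 0 < β ^ j := by positivity
      simpa using this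
    · simpa using h0
    · simpa using h1
  | succ k ih =>
    intro ξ h0 h1
    have hp : 0 < β ^ k := by positivity
    set m := ⌊ξ / β ^ k⌋₊ with hm
    have hm1 : (m : ℝ) * β ^ k ≤ ξ := by
      rw [← le_div_iff₀ hp]
      exact Nat.floor_le (by positivity)
    have hm2 : ξ < (m + 1 : ℝ) * β ^ k := by
      rw [← div_lt_iff₀ hp]
      exact Nat.lt_floor_add_one _
    obtain ⟨d, hd, hg, hl, hu⟩ := ih (ξ - m * β ^ k) (by linarith) (by linarith)
    have hsum : ∀ j ≤ k, ∑ i ∈ Finset.range j, ((Function.update d k m) i : ℝ) * β ^ i =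
        ∑ i ∈ Finset.range j, (d i : ℝ) * β ^ i := by
      intro j hj
      refine Finset.sum_congr rfl fun i hi => ?_
      have : i < j := by simpa using hi
      rw [Function.update_of_ne (by omega)]
    have htop : ∑ i ∈ Finset.range (k + 1), ((Function.update d k m) i : ℝ) * β ^ i =
        ∑ i ∈ Finset.range k, (d i : ℝ) * β ^ i + m * β ^ k := by
      rw [Finset.sum_range_succ, hsum k le_rfl, Function.update_self]
    have hzero : ∀ i, k + 1 ≤ i → Function.update d k m i = 0 := fun i hi => by
      rw [Function.update_of_ne (by omega)]
      exact hd i (by omega)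
    refine ⟨Function.update d k m, hzero, ?_, by linarith, by linarith⟩
    intro j
    rcases le_or_gt j k with hj | hj
    · rw [hsum j hj]
      exact hg j
    · have hext : ∑ i ∈ Finset.range j, ((Function.update d k m) i : ℝ) * β ^ i =
          ∑ i ∈ Finset.range (k + 1), ((Function.update d k m) i : ℝ) * β ^ i := by
        symm
        refine Finset.sum_subset (Finset.range_mono hj) fun i _ hi => ?_
        rw [hzero i (by simpa using hi)]
        simp
      have : β ^ (k + 1) ≤ β ^ j := pow_le_pow_right₀ hβ.le hj
      linarith

/-- Every non-negative real is less than `1` away from a `β`-integer below it. -/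
theorem exists_betaInteger_near {β ξ : ℝ} (hβ : 1 < β) (h0 : 0 ≤ ξ) :
    ∃ y ∈ betaIntegers β, y ≤ ξ ∧ ξ < y + 1 := by
  obtain ⟨k, hk⟩ := pow_unbounded_of_one_lt ξ hβ
  obtain ⟨d, hd, hg, hl, hu⟩ := exists_greedy_digits hβ k ξ h0 hk
  exact ⟨_, sum_digits_mem_betaIntegers hβ hd hg, hl, hu⟩

/-- `β` and `β'` are the two irrational roots of `X ^ 2 - a X - b`, and `β > 1` is dominant. -/
structure IsDominantQuadraticPair (β β' : ℝ) (a b : ℤ) : Prop where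
  one_lt : 1 < β
  irrational : Irrational β
  sq_eq : β ^ 2 = a * β + b
  conj_eq : β' = a - β
  abs_conj_lt : |β'| < β

/-- `x` and `y` are corresponding elements of `ℤ[β]` and `ℤ[β']`. -/
def ConjPair (β β' x y : ℝ) : Prop := ∃ u v : ℤ, x = u + v * β ∧ y = u + v * β'

namespace IsDominantQuadraticPair

variable {β β' : ℝ} {a b : ℤ}

theorem conj_sq_eq (h : IsDominantQuadraticPair β β' a b) : β' ^ 2 = a * β' + b := by
  rw [h.conj_eq]
  linear_combination h.sq_eq

theorem conj_lt (h : IsDominantQuadraticPair β β' a b) : β' < β :=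
  (le_abs_self _).trans_lt h.abs_conj_lt

end IsDominantQuadraticPair

namespace ConjPair

variable {β β' : ℝ} {a b : ℤ} {x y x₂ y₂ : ℝ}

theorem add (h₁ : ConjPair β β' x y) (h₂ : ConjPair β β' x₂ y₂) :
    ConjPair β β' (x + x₂) (y + y₂) := by
  obtain ⟨u, v, rfl, rfl⟩ := h₁
  obtain ⟨u', v', rfl, rfl⟩ := h₂
  exact ⟨u + u', v + v', by push_cast; ring, by push_cast; ring⟩

theorem neg (h₁ : ConjPair β β' x y) : ConjPair β β' (-x) (-y) := by
  obtain ⟨u, v, rfl, rfl⟩ := h₁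
  exact ⟨-u, -v, by push_cast; ring, by push_cast; ring⟩

theorem mul (h : IsDominantQuadraticPair β β' a b) (h₁ : ConjPair β β' x y)
    (h₂ : ConjPair β β' x₂ y₂) : ConjPair β β' (x * x₂) (y * y₂) := by
  obtain ⟨u, v, rfl, rfl⟩ := h₁
  obtain ⟨u', v', rfl, rfl⟩ := h₂
  refine ⟨u * u' + b * (v * v'), u * v' + v * u' + a * (v * v'), ?_, ?_⟩
  · push_cast
    linear_combination (v * v' : ℝ) * h.sq_eq
  · push_cast
    linear_combination (v * v' : ℝ) * h.conj_sq_eq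

theorem natCast (n : ℕ) : ConjPair β β' n n := ⟨n, 0, by simp, by simp⟩

theorem pow (h : IsDominantQuadraticPair β β' a b) (n : ℕ) : ConjPair β β' (β ^ n) (β' ^ n) := by
  induction n with
  | zero => simpa using natCast (β := β) (β' := β') 1
  | succ n ih =>
    rw [pow_succ, pow_succ]
    exact ih.mul h ⟨0, 1, by simp, by simp⟩

theorem right_ne_zero (h : IsDominantQuadraticPair β β' a b) (h₁ : ConjPair β β' x y)
    (hx : x ≠ 0) : y ≠ 0 := by
  obtain ⟨u, v, rfl, rfl⟩ := h₁
  intro hy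
  rcases eq_or_ne v 0 with rfl | hv
  · apply hx
    simpa using hy
  · have hv' : (v : ℝ) ≠ 0 := by exact_mod_cast hv
    refine h.irrational ⟨(a + u / v : ℚ), ?_⟩
    have hβ : β' = -(u / v) := by
      field_simp
      linarith
    have := h.conj_eq
    push_cast
    linarith

theorem mem_adjoin (h₁ : ConjPair β β' x y) :
    x ∈ IntermediateField.adjoin ℚ ({β} : Set ℝ) := by
  obtain ⟨u, v, rfl, rfl⟩ := h₁
  exact add_mem (intCast_mem _ _)
    (mul_mem (intCast_mem _ _) (IntermediateField.mem_adjoin_simple_self ℚ β))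

end ConjPair

theorem abs_mul_pos_eq {x δ : ℝ} (hδ : 0 < δ) : |x * δ| = |x| * δ := by
  rw [abs_mul, abs_of_pos hδ]

theorem abs_add_abs_eq_max (x y : ℝ) : |x| + |y| = max |x + y| |x - y| := by
  rcases abs_cases x with ⟨h1, _⟩ | ⟨h1, _⟩ <;> rcases abs_cases y with ⟨h2, _⟩ | ⟨h2, _⟩ <;>
    rcases abs_cases (x + y) with ⟨h3, _⟩ | ⟨h3, _⟩ <;>
    rcases abs_cases (x - y) with ⟨h4, _⟩ | ⟨h4, _⟩ <;>
    rcases max_cases |x + y| |x - y| with ⟨h5, _⟩ | ⟨h5, _⟩ <;> linarith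

/-- The quantity `x |y₂| + x₂ |y|`, which does not increase along the algorithm, takes discrete
values. -/
theorem ConjPair.mixed_abs_eq {β β' : ℝ} {a b : ℤ} (h : IsDominantQuadraticPair β β' a b)
    {x y x₂ y₂ : ℝ} (h₁ : ConjPair β β' x y) (h₂ : ConjPair β β' x₂ y₂) (hx : 0 ≤ x)
    (hx₂ : 0 ≤ x₂) :
    ∃ s t : ℤ, x * |y₂| + x₂ * |y| = max |(s : ℝ)| (|(t : ℝ)| * (β - β')) := by
  have e : x * |y₂| + x₂ * |y| = |x * y₂| + |x₂ * y| := by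
    rw [abs_mul, abs_mul, abs_of_nonneg hx, abs_of_nonneg hx₂]
  obtain ⟨u, v, rfl, rfl⟩ := h₁
  obtain ⟨u', v', rfl, rfl⟩ := h₂
  refine ⟨2 * (u * u') - 2 * b * (v * v') + a * (u * v' + v * u'), v * u' - u * v', ?_⟩
  have hc := h.conj_eq
  have hb : β * β' = -b := by
    rw [hc]
    linear_combination -h.sq_eq
  rw [e, abs_add_abs_eq_max]
  congr 1
  · congr 1
    push_cast
    linear_combination (2 * v * v' : ℝ) * hb + (u * v' + v * u' : ℝ) * hc
  · rw [← abs_mul_pos_eq (sub_pos.2 h.conj_lt)]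
    congr 1
    push_cast
    ring

theorem finite_abs_intCast_le (B : ℝ) : {s : ℤ | |(s : ℝ)| ≤ B}.Finite := by
  refine (Set.finite_Icc (-⌈B⌉) ⌈B⌉).subset fun s hs => ?_
  have h := abs_le.1 (le_trans (Set.mem_ofPred_eq ▸ hs) (Int.le_ceil B))
  exact ⟨by exact_mod_cast h.1, by exact_mod_cast h.2⟩

theorem finite_max_abs_le {δ : ℝ} (hδ : 0 < δ) (B : ℝ) :
    {w : ℝ | w ≤ B ∧ ∃ s t : ℤ, w = max |(s : ℝ)| (|(t : ℝ)| * δ)}.Finite := by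
  refine (((finite_abs_intCast_le B).prod (finite_abs_intCast_le (B / δ))).image
    (fun p : ℤ × ℤ => max |(p.1 : ℝ)| (|(p.2 : ℝ)| * δ))).subset ?_
  rintro w ⟨hw, s, t, rfl⟩
  refine ⟨(s, t), ⟨(le_max_left _ _).trans hw, ?_⟩, rfl⟩
  rw [Set.mem_ofPred_eq, le_div_iff₀ hδ]
  exact (le_max_right _ _).trans hw

theorem exists_conj_of_mem_betaIntegers {β β' : ℝ} {a b : ℤ}
    (h : IsDominantQuadraticPair β β' a b) {z : ℝ} (hz : z ∈ betaIntegers β) (h0 : 0 ≤ z) :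
    ∃ y, ConjPair β β' z y ∧ |y| ≤ z ∧ (|y| = z → ∃ n : ℕ, z = n ∧ (n : ℝ) < β) := by
  obtain ⟨k, d, hlt, hs⟩ := exists_digits_of_mem_betaIntegers hz
  rw [abs_of_nonneg h0] at hs
  have hle : ∀ i ∈ Finset.range k, |(d i : ℝ) * β' ^ i| ≤ (d i : ℝ) * β ^ i := by
    intro i _
    rw [abs_mul, abs_pow, Nat.abs_cast]
    have := h.abs_conj_lt
    gcongr
  refine ⟨∑ i ∈ Finset.range k, (d i : ℝ) * β' ^ i, ?_, ?_, ?_⟩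
  · rw [hs]
    clear hs hle
    induction k with
    | zero => simpa using ConjPair.natCast (β := β) (β' := β') 0
    | succ k ih =>
      rw [Finset.sum_range_succ, Finset.sum_range_succ]
      exact ih.add ((ConjPair.natCast _).mul h (ConjPair.pow h k))
  · rw [hs]
    exact (Finset.abs_sum_le_sum_abs _ _).trans (Finset.sum_le_sum hle)
  · intro he
    have heq : ∑ i ∈ Finset.range k, |(d i : ℝ) * β' ^ i| =
        ∑ i ∈ Finset.range k, (d i : ℝ) * β ^ i := by
      refine le_antisymm (Finset.sum_le_sum hle) ?_
      rw [← hs, ← he]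
      exact Finset.abs_sum_le_sum_abs _ _
    rw [Finset.sum_eq_sum_iff_of_le hle] at heq
    have hz : ∀ i ∈ Finset.range k, i ≠ 0 → d i = 0 := by
      intro i hi hi0
      by_contra hd
      have h1 := heq i hi
      rw [abs_mul, abs_pow, Nat.abs_cast] at h1
      have h2 : (d i : ℝ) ≠ 0 := by exact_mod_cast hd
      have h3 := mul_left_cancel₀ h2 h1
      have h4 := pow_lt_pow_left₀ h.abs_conj_lt (abs_nonneg _) hi0
      linarith
    rcases Nat.eq_zero_or_pos k with rfl | hk
    · exact ⟨0, by simpa using hs, by simpa using zero_lt_one.trans h.one_lt⟩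
    · refine ⟨d 0, ?_, hlt 0⟩
      rw [hs, Finset.sum_eq_single_of_mem 0 (by simpa using hk)]
      · simp
      · intro i hi hi0
        simp [hz i hi hi0]

theorem finite_betaIntegers_abs_le {β β' : ℝ} {a b : ℤ} (h : IsDominantQuadraticPair β β' a b)
    (B : ℝ) : {z | z ∈ betaIntegers β ∧ |z| ≤ B}.Finite := by
  have hδ := sub_pos.2 h.conj_lt
  have hβ := zero_lt_one.trans h.one_lt
  set C := 2 * B / (β - β')
  refine (((finite_abs_intCast_le (B + C * β)).prod (finite_abs_intCast_le C)).image
    (fun p : ℤ × ℤ => (p.1 : ℝ) + p.2 * β)).subset ?_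
  rintro z ⟨hz, hzB⟩
  have hex : ∃ y, ConjPair β β' z y ∧ |y| ≤ |z| := by
    rcases le_total 0 z with h0 | h0
    · obtain ⟨y, hy, hle, -⟩ := exists_conj_of_mem_betaIntegers h hz h0
      exact ⟨y, hy, by rwa [abs_of_nonneg h0]⟩
    · obtain ⟨y, hy, hle, -⟩ :=
        exists_conj_of_mem_betaIntegers h (neg_mem_betaIntegers hz) (neg_nonneg.2 h0)
      exact ⟨-y, by simpa using hy.neg, by rwa [abs_of_nonpos h0, abs_neg]⟩
  obtain ⟨y, ⟨u, v, huv, hy⟩, hle⟩ := hex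
  have hv : |(v : ℝ)| ≤ C := by
    rw [le_div_iff₀ hδ, ← abs_mul_pos_eq hδ]
    calc |(v : ℝ) * (β - β')| = |z - y| := by rw [huv, hy]; ring_nf
      _ ≤ |z| + |y| := abs_sub _ _
      _ ≤ 2 * B := by linarith
  refine ⟨(u, v), ⟨?_, hv⟩, huv.symm⟩
  calc |(u : ℝ)| = |z - v * β| := by rw [huv]; ring_nf
    _ ≤ |z| + |v * β| := abs_sub _ _
    _ ≤ B + C * β := by
      rw [abs_mul, abs_of_pos hβ]
      gcongr

theorem isGreatest_mFloor {β β' : ℝ} {a b : ℤ} (h : IsDominantQuadraticPair β β' a b) (ξ : ℝ) :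
    IsGreatest {y | y ∈ betaIntegers β ∧ y ≤ ξ} (mFloor (betaIntegers β) ξ) := by
  obtain ⟨k, hk⟩ := pow_unbounded_of_one_lt (-ξ) h.one_lt
  have hmem : -β ^ k ∈ betaIntegers β := neg_mem_betaIntegers (pow_mem_betaIntegers h.one_lt k)
  set F := {y | (y ∈ betaIntegers β ∧ y ≤ ξ) ∧ -β ^ k ≤ y} with hF
  have hfin : F.Finite := by
    refine (finite_betaIntegers_abs_le h (max |ξ| (β ^ k))).subset ?_
    rintro y ⟨⟨hy, hyξ⟩, hyk⟩
    refine ⟨hy, abs_le.2 ⟨?_, ?_⟩⟩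
    · linarith [le_max_right |ξ| (β ^ k)]
    · linarith [le_max_left |ξ| (β ^ k), le_abs_self ξ]
  obtain ⟨m, hm, hmax⟩ := Set.exists_max_image F id hfin ⟨-β ^ k, ⟨hmem, by linarith⟩, le_rfl⟩
  have hg : IsGreatest {y | y ∈ betaIntegers β ∧ y ≤ ξ} m := by
    refine ⟨hm.1, fun y hy => ?_⟩
    rcases le_total (-β ^ k) y with hy' | hy'
    · exact hmax y ⟨hy, hy'⟩
    · exact hy'.trans hm.2
  rw [mFloor, hg.csSup_eq]
  exact hg

/-- One step of the algorithm, from a non-negative complete quotient which is not a `β`-integer. -/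
theorem mFloor_spec {β β' : ℝ} {a b : ℤ} (h : IsDominantQuadraticPair β β' a b) {ξ : ℝ}
    (h0 : 0 ≤ ξ) (hξ : ξ ∉ betaIntegers β) :
    0 ≤ mFloor (betaIntegers β) ξ ∧ mFloor (betaIntegers β) ξ < ξ ∧
      ξ < mFloor (betaIntegers β) ξ + 1 := by
  have hg := isGreatest_mFloor h ξ
  obtain ⟨y, hy, hy1, hy2⟩ := exists_betaInteger_near h.one_lt h0
  have hzero : (0 : ℝ) ∈ betaIntegers β := by
    have hlt : ((0 : ℕ) : ℝ) < β := by simpa using zero_lt_one.trans h.one_lt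
    simpa using natCast_mem_betaIntegers h.one_lt hlt
  refine ⟨hg.2 ⟨hzero, h0⟩, ?_, ?_⟩
  · exact lt_of_le_of_ne hg.1.2 fun he => hξ (he ▸ hg.1.1)
  · have := hg.2 ⟨hy, hy1⟩
    linarith

theorem exists_int_of_mem_adjoin {β β' : ℝ} {a b : ℤ} (h : IsDominantQuadraticPair β β' a b)
    {ξ : ℝ} (hξ : ξ ∈ IntermediateField.adjoin ℚ ({β} : Set ℝ)) :
    ∃ (u v : ℤ) (w : ℕ), 0 < w ∧ ξ = (u + v * β) / w := by
  have hint : IsIntegral ℚ β := by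
    refine ⟨Polynomial.X ^ 2 + (-Polynomial.C (a : ℚ) * Polynomial.X - Polynomial.C (b : ℚ)),
      ?_, ?_⟩
    · apply Polynomial.monic_X_pow_add
      compute_degree!
    · rw [← Polynomial.aeval_def]
      simp
      linarith [h.sq_eq]
  have hrat : ∃ r s : ℚ, ξ = r + s * β := by
    rw [← IntermediateField.mem_toSubalgebra,
      IntermediateField.adjoin_simple_toSubalgebra_of_isAlgebraic hint.isAlgebraic] at hξ
    induction hξ using Algebra.adjoin_induction with
    | mem x hx => exact ⟨0, 1, by simpa using hx⟩
    | algebraMap r => exact ⟨r, 0, by simp⟩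
    | add x y _ _ hx hy =>
      obtain ⟨r, s, rfl⟩ := hx
      obtain ⟨r', s', rfl⟩ := hy
      exact ⟨r + r', s + s', by push_cast; ring⟩
    | mul x y _ _ hx hy =>
      obtain ⟨r, s, rfl⟩ := hx
      obtain ⟨r', s', rfl⟩ := hy
      refine ⟨r * r' + b * (s * s'), r * s' + s * r' + a * (s * s'), ?_⟩
      push_cast
      linear_combination (s * s' : ℝ) * h.sq_eq
  obtain ⟨r, s, rfl⟩ := hrat
  refine ⟨r.num * s.den, s.num * r.den, r.den * s.den, Nat.mul_pos r.pos s.pos, ?_⟩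
  have hr : (r.den : ℝ) ≠ 0 := by exact_mod_cast r.den_nz
  have hs : (s.den : ℝ) ≠ 0 := by exact_mod_cast s.den_nz
  have hr' : (r : ℝ) = r.num / r.den := by exact_mod_cast (Rat.num_div_den r).symm
  have hs' : (s : ℝ) = s.num / s.den := by exact_mod_cast (Rat.num_div_den s).symm
  rw [hr', hs']
  push_cast
  field_simp

/-- `ξ = x / x₂` with `x, x₂ ∈ ℤ[β]` positive and mixed size `x |y₂| + x₂ |y| = w`. -/
def HasMixedSize (β β' ξ w : ℝ) : Prop :=
  ∃ x y x₂ y₂ : ℝ, ConjPair β β' x y ∧ ConjPair β β' x₂ y₂ ∧ 0 < x ∧ 0 < x₂ ∧ ξ = x / x₂ ∧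
    w = x * |y₂| + x₂ * |y|

theorem HasMixedSize.step {β β' : ℝ} {a b : ℤ} (h : IsDominantQuadraticPair β β' a b) {ξ w : ℝ}
    (hξ : ξ ∉ betaIntegers β) (hw : HasMixedSize β β' ξ w) :
    ∃ w' ≤ w, HasMixedSize β β' (1 / (ξ - mFloor (betaIntegers β) ξ)) w' ∧
      (w' = w → ∃ n : ℕ, mFloor (betaIntegers β) ξ = n ∧ (n : ℝ) < β) := by
  obtain ⟨x, y, x₂, y₂, h₁, h₂, hx, hx₂, hdiv, rfl⟩ := hw
  have hξ0 : 0 ≤ ξ := by rw [hdiv]; positivity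
  obtain ⟨hm0, hm1, hm2⟩ := mFloor_spec h hξ0 hξ
  obtain ⟨m', hm', hle, heq⟩ := exists_conj_of_mem_betaIntegers h (isGreatest_mFloor h ξ).1.1 hm0
  set m := mFloor (betaIntegers β) ξ
  have hx₃ : 0 < x - m * x₂ := by
    rw [hdiv, lt_div_iff₀ hx₂] at hm1
    linarith
  have hy₂ : 0 < |y₂| := abs_pos.2 (h₂.right_ne_zero h hx₂.ne')
  have htri : |y - m' * y₂| ≤ |y| + |m'| * |y₂| := by
    rw [← abs_mul]
    exact abs_sub _ _
  have hbound : x₂ * |y - m' * y₂| + (x - m * x₂) * |y₂| ≤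
      x * |y₂| + x₂ * |y| - x₂ * |y₂| * (m - |m'|) := by
    have := mul_le_mul_of_nonneg_left htri hx₂.le
    linarith
  have hpos : 0 < x₂ * |y₂| := by positivity
  refine ⟨x₂ * |y - m' * y₂| + (x - m * x₂) * |y₂|, ?_, ?_, ?_⟩
  · have := mul_nonneg hpos.le (sub_nonneg.2 hle)
    linarith
  · refine ⟨x₂, y₂, x - m * x₂, y - m' * y₂, h₂, ?_, hx₂, hx₃, ?_, rfl⟩
    · simpa [sub_eq_add_neg] using h₁.add (hm'.mul h h₂).neg
    · rw [hdiv]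
      have := hx₃.ne'
      have := hx₂.ne'
      field_simp
  · intro hw
    apply heq
    refine le_antisymm hle ?_
    by_contra! hc
    have := mul_pos hpos (sub_pos.2 hc)
    linarith

theorem HasMixedSize.eventually_natCast {β β' : ℝ} {a b : ℤ}
    (h : IsDominantQuadraticPair β β' a b) {ξ : ℕ → ℝ} (hξ : ∀ n, ξ n ∉ betaIntegers β)
    (hstep : ∀ n, ξ (n + 1) = 1 / (ξ n - mFloor (betaIntegers β) (ξ n))) {w₀ : ℝ}
    (hw₀ : HasMixedSize β β' (ξ 0) w₀) :
    ∃ N, ∀ n, N ≤ n → ∃ k : ℕ, mFloor (betaIntegers β) (ξ n) = k ∧ (k : ℝ) < β := by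
  set F := {w | w ≤ w₀ ∧ ∃ n, HasMixedSize β β' (ξ n) w} with hF
  have hfin : F.Finite := by
    refine (finite_max_abs_le (sub_pos.2 h.conj_lt) w₀).subset ?_
    rintro w ⟨hw, n, x, y, x₂, y₂, h₁, h₂, hx, hx₂, -, rfl⟩
    exact ⟨hw, h₁.mixed_abs_eq h h₂ hx.le hx₂.le⟩
  obtain ⟨w, ⟨hw, N, hN⟩, hmin⟩ := Set.exists_min_image F id hfin ⟨w₀, le_rfl, 0, hw₀⟩
  have key : ∀ n, HasMixedSize β β' (ξ n) w → HasMixedSize β β' (ξ (n + 1)) w ∧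
      ∃ k : ℕ, mFloor (betaIntegers β) (ξ n) = k ∧ (k : ℝ) < β := by
    intro n hn
    obtain ⟨w', hle, hw', heq⟩ := hn.step h (hξ n)
    rw [← hstep] at hw'
    have hww : w' = w := le_antisymm hle (hmin w' ⟨hle.trans hw, n + 1, hw'⟩)
    exact ⟨hww ▸ hw', heq hww⟩
  have hall : ∀ n, N ≤ n → HasMixedSize β β' (ξ n) w := by
    intro n hn
    induction n, hn using Nat.le_induction with
    | base => exact hN
    | succ n _ ih => exact (key n ih).1
  exact ⟨N, fun n hn => (key n (hall n hn)).2⟩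

/-- An infinite expansion of an element of `ℚ(β)` eventually is a classical continued fraction with
partial quotients smaller than `β`. -/
theorem exists_classical_tail {β β' : ℝ} {a b : ℤ} (h : IsDominantQuadraticPair β β' a b)
    (hc : ¬ CFF β) :
    ∃ (t : ℕ → ℝ) (k : ℕ → ℕ), ∀ n, t n ∈ IntermediateField.adjoin ℚ ({β} : Set ℝ) ∧
      t n ∉ betaIntegers β ∧ t n < β ∧ 1 < t n ∧ 1 ≤ k n ∧ t n = k n + 1 / t (n + 1) := by
  simp only [CFF, HasFiniteExpansion, not_forall, not_exists] at hc
  obtain ⟨ξ, hξK, hξ⟩ := hc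
  set c := completeQuotient (betaIntegers β) ξ with hcdef
  have hstep : ∀ n, c (n + 1) = 1 / (c n - mFloor (betaIntegers β) (c n)) := fun n => rfl
  have hlt : ∀ n, mFloor (betaIntegers β) (c n) < c n := fun n =>
    lt_of_le_of_ne (isGreatest_mFloor h (c n)).1.2
      fun he => hξ n (he ▸ (isGreatest_mFloor h (c n)).1.1)
  have hpos : ∀ n, 0 < c (n + 1) := fun n => by
    rw [hstep]
    exact one_div_pos.2 (sub_pos.2 (hlt n))
  have hone : ∀ n, 1 < c (n + 2) := fun n => by
    rw [hstep, lt_div_iff₀ (sub_pos.2 (hlt _)), one_mul]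
    linarith [(mFloor_spec h (hpos n).le (hξ _)).2.2]
  have hmemM : ∀ z ∈ betaIntegers β, z ∈ IntermediateField.adjoin ℚ ({β} : Set ℝ) := by
    intro z hz
    rcases le_total 0 z with h0 | h0
    · obtain ⟨y, hy, -⟩ := exists_conj_of_mem_betaIntegers h hz h0
      exact hy.mem_adjoin
    · obtain ⟨y, hy, -⟩ :=
        exists_conj_of_mem_betaIntegers h (neg_mem_betaIntegers hz) (neg_nonneg.2 h0)
      simpa using neg_mem hy.mem_adjoin
  have hK : ∀ n, c n ∈ IntermediateField.adjoin ℚ ({β} : Set ℝ) := by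
    intro n
    induction n with
    | zero => exact hξK
    | succ n ih =>
      rw [hstep]
      exact div_mem (one_mem _) (sub_mem ih (hmemM _ (isGreatest_mFloor h (c n)).1.1))
  obtain ⟨u, v, w, hw, huv⟩ := exists_int_of_mem_adjoin h (hK 1)
  have hw' : (0 : ℝ) < w := by exact_mod_cast hw
  have hnum : 0 < (u : ℝ) + v * β := by
    have := hpos 0
    rw [huv] at this
    exact (div_pos_iff_of_pos_right hw').1 this
  obtain ⟨N, hN⟩ := HasMixedSize.eventually_natCast h (ξ := fun n => c (n + 1))
    (fun n => hξ (n + 1)) (fun n => hstep (n + 1))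
    ⟨u + v * β, u + v * β', w, w, ⟨u, v, rfl, rfl⟩, ConjPair.natCast w, hnum, hw', huv, rfl⟩
  choose! k hk hkβ using hN
  refine ⟨fun n => c (N + n + 2), fun n => k (N + n + 1), fun n => ?_⟩
  have hk' := hk (N + n + 1) (by omega)
  have hkβ' := hkβ (N + n + 1) (by omega)
  have hg := isGreatest_mFloor h (c (N + n + 2))
  rw [hk'] at hg
  have hsp := mFloor_spec h (hpos (N + n + 1)).le (hξ _)
  refine ⟨hK _, hξ _, ?_, hone _, ?_, ?_⟩
  · by_contra! hc
    have := hg.2 ⟨by simpa using pow_mem_betaIntegers h.one_lt 1, hc⟩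
    linarith
  · have := hone (N + n)
    rw [hk'] at hsp
    have h0 : (0 : ℝ) < k (N + n + 1) := by linarith
    exact_mod_cast h0
  · have := hstep (N + n + 2)
    rw [hk'] at this
    change c (N + n + 2) = k (N + n + 1) + 1 / c (N + (n + 1) + 2)
    rw [show N + (n + 1) + 2 = N + n + 2 + 1 by ring, this]
    simp

theorem eq_of_constant_tails {t : ℕ → ℝ} {k c B : ℝ} (ht : ∀ n, 1 < t n) (hB : ∀ n, t n < B)
    (hrec : ∀ n, t n = k + 1 / t (n + 1)) (hc : 1 < c) (hfix : c = k + 1 / c) : t 0 = c := by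
  have hgrow : ∀ n, c ^ n * |t 0 - c| ≤ |t n - c| := by
    intro n
    induction n with
    | zero => simp
    | succ n ih =>
      have h1 := ht (n + 1)
      have h2 : t (n + 1) - c = -(c * t (n + 1)) * (t n - c) := by
        have e1 := hrec n
        have e2 : t n - c = 1 / t (n + 1) - 1 / c := by linarith
        rw [e2]
        have : t (n + 1) ≠ 0 := by linarith
        have : c ≠ 0 := by linarith
        field_simp
        ring
      have hct : 0 < c * t (n + 1) := mul_pos (by linarith) (by linarith)
      rw [h2, abs_mul, abs_neg, abs_of_pos hct, pow_succ']
      calc c * c ^ n * |t 0 - c| = c * (c ^ n * |t 0 - c|) := by ring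
        _ ≤ c * |t n - c| := by gcongr
        _ ≤ c * t (n + 1) * |t n - c| := by
          have : 0 ≤ c * |t n - c| := by positivity
          nlinarith
  by_contra hne
  have hpos : 0 < |t 0 - c| := abs_pos.2 (sub_ne_zero.2 hne)
  obtain ⟨n, hn⟩ := pow_unbounded_of_one_lt ((B + c) / |t 0 - c|) hc
  rw [div_lt_iff₀ hpos] at hn
  have h1 := hgrow n
  have h2 : |t n - c| ≤ B + c := by
    have := ht n
    have := hB n
    rw [abs_le]
    constructor <;> linarith
  linarith

theorem isDominantQuadraticPair_of_sqrt {a b : ℤ} {Δ : ℕ} (ha : 0 < a) (hΔ : (Δ : ℤ) = a ^ 2 + 4 * b)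
    (hsq : ¬ IsSquare Δ) (h1 : (2 - a : ℝ) < √Δ) :
    IsDominantQuadraticPair ((a + √Δ) / 2) ((a - √Δ) / 2) a b := by
  have hirr : Irrational √(Δ : ℝ) := irrational_sqrt_natCast_iff.2 hsq
  have hs : √(Δ : ℝ) ^ 2 = a ^ 2 + 4 * b := by
    rw [Real.sq_sqrt (Nat.cast_nonneg _)]
    exact_mod_cast hΔ
  have ha' : (0 : ℝ) < a := by exact_mod_cast ha
  have hpos : 0 < √(Δ : ℝ) := lt_of_le_of_ne (Real.sqrt_nonneg _) fun h => hirr ⟨0, by simpa using h⟩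
  refine ⟨by linarith, ?_, by linarith, by ring, ?_⟩
  · exact_mod_cast (hirr.intCast_add a).div_natCast (two_ne_zero)
  · rw [abs_lt]
    constructor <;> linarith

theorem sqrt_notMem_adjoin {β β' : ℝ} {a b : ℤ} (h : IsDominantQuadraticPair β β' a b) {D E : ℕ}
    {r s : ℚ} (hβ : β = r + s * √D) (hD : ¬ IsSquare D) (hE : ¬ IsSquare E)
    (hDE : ¬ IsSquare (D * E)) : √(E : ℝ) ∉ IntermediateField.adjoin ℚ ({β} : Set ℝ) := by
  intro hmem
  obtain ⟨u, v, w, hw, huv⟩ := exists_int_of_mem_adjoin h hmem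
  have hD' : Irrational √(D : ℝ) := irrational_sqrt_natCast_iff.2 hD
  have hE' : Irrational √(E : ℝ) := irrational_sqrt_natCast_iff.2 hE
  have hDE' : Irrational √((D * E : ℕ) : ℝ) := irrational_sqrt_natCast_iff.2 hDE
  have hsD : √(D : ℝ) ^ 2 = D := Real.sq_sqrt (Nat.cast_nonneg _)
  have hsE : √(E : ℝ) ^ 2 = E := Real.sq_sqrt (Nat.cast_nonneg _)
  have hform : ∃ p q : ℚ, √(E : ℝ) = p + q * √D := by
    refine ⟨(u + v * r) / w, v * s / w, ?_⟩
    rw [huv, hβ]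
    push_cast
    ring
  obtain ⟨p, q, hpq⟩ := hform
  rcases eq_or_ne p 0 with rfl | hp
  · refine hDE' ⟨D * q, ?_⟩
    push_cast
    rw [Real.sqrt_mul (Nat.cast_nonneg _), hpq]
    push_cast
    linear_combination (-q : ℝ) * hsD
  rcases eq_or_ne q 0 with rfl | hq
  · exact hE' ⟨p, by simpa using hpq.symm⟩
  · refine hD' ⟨(E - p ^ 2 - q ^ 2 * D) / (2 * p * q), ?_⟩
    have hp' : (p : ℝ) ≠ 0 := by exact_mod_cast hp
    have hq' : (q : ℝ) ≠ 0 := by exact_mod_cast hq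
    push_cast
    rw [div_eq_iff (by positivity), ← hsE, hpq]
    linear_combination (q ^ 2 : ℝ) * hsD

theorem eq_golden_of_ones {t : ℕ → ℝ} {B : ℝ} (ht : ∀ n, 1 < t n) (hB : ∀ n, t n < B)
    (hrec : ∀ n, t n = 1 + 1 / t (n + 1)) : t 0 = (1 + √5) / 2 := by
  have h5 : √5 ^ 2 = (5 : ℝ) := Real.sq_sqrt (by norm_num)
  have h2 : 2 < √(5 : ℝ) := Real.lt_sqrt_of_sq_lt (by norm_num)
  refine eq_of_constant_tails ht hB hrec (by linarith) ?_
  have : (1 + √5) ≠ 0 := by positivity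
  field_simp
  linarith

theorem eq_one_add_sqrt_two_of_twos {t : ℕ → ℝ} {B : ℝ} (ht : ∀ n, 1 < t n) (hB : ∀ n, t n < B)
    (hrec : ∀ n, t n = 2 + 1 / t (n + 1)) : t 0 = 1 + √2 := by
  have h5 : √2 ^ 2 = (2 : ℝ) := Real.sq_sqrt (by norm_num)
  have h2 : 1 < √(2 : ℝ) := Real.lt_sqrt_of_sq_lt (by norm_num)
  refine eq_of_constant_tails ht hB hrec (by linarith) ?_
  have : (1 + √2) ≠ 0 := by positivity
  field_simp
  linarith

theorem sqrt_five_mem_of_ones {K : IntermediateField ℚ ℝ} {t : ℕ → ℝ} {B : ℝ}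
    (ht : ∀ n, 1 < t n) (hB : ∀ n, t n < B) (hrec : ∀ n, t n = 1 + 1 / t (n + 1))
    (hK : t 0 ∈ K) : √5 ∈ K := by
  rw [eq_golden_of_ones ht hB hrec] at hK
  have : √5 = 2 * ((1 + √5) / 2) - (1 : ℝ) := by ring
  rw [this]
  exact sub_mem (mul_mem (ofNat_mem K 2) hK) (one_mem K)

theorem natCast_eq_one_or_two {k : ℕ} {t s β : ℝ} (h1 : 1 ≤ k) (hβ : β < 3) (ht : t < β)
    (hs : 1 < s) (h : t = k + 1 / s) : k = 1 ∨ k = 2 := by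
  have : 0 < 1 / s := by positivity
  have h3 : (k : ℝ) < (3 : ℕ) := by push_cast; linarith
  have : k < 3 := by exact_mod_cast h3
  omega

theorem isDominantQuadraticPair_golden :
    IsDominantQuadraticPair ((1 + √5) / 2) ((1 - √5) / 2) 1 1 := by
  have h2 : 2 < √(5 : ℝ) := Real.lt_sqrt_of_sq_lt (by norm_num)
  simpa using isDominantQuadraticPair_of_sqrt (a := 1) (b := 1) (Δ := 5) (by norm_num)
    (by norm_num) (by norm_num) (by norm_num; linarith)

theorem sqrt_eight : √(8 : ℝ) = 2 * √2 := by
  rw [show (8 : ℝ) = 2 ^ 2 * 2 by norm_num, Real.sqrt_mul (by norm_num), Real.sqrt_sq (by norm_num)]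

theorem sqrt_twelve : √(12 : ℝ) = 2 * √3 := by
  rw [show (12 : ℝ) = 2 ^ 2 * 3 by norm_num, Real.sqrt_mul (by norm_num),
    Real.sqrt_sq (by norm_num)]

theorem isDominantQuadraticPair_one_add_sqrt_two :
    IsDominantQuadraticPair (1 + √2) (1 - √2) 2 1 := by
  have h2 : 0 < √(2 : ℝ) := by positivity
  have h := isDominantQuadraticPair_of_sqrt (a := 2) (b := 1) (Δ := 8) (by norm_num)
    (by norm_num) (by norm_num) (by push_cast; rw [sqrt_eight]; linarith)
  push_cast at h
  rw [sqrt_eight] at h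
  convert h using 1 <;> ring

theorem isDominantQuadraticPair_sqrt_thirteen :
    IsDominantQuadraticPair ((1 + √13) / 2) ((1 - √13) / 2) 1 3 := by
  have h2 : 2 < √(13 : ℝ) := Real.lt_sqrt_of_sq_lt (by norm_num)
  simpa using isDominantQuadraticPair_of_sqrt (a := 1) (b := 3) (Δ := 13) (by norm_num)
    (by norm_num) (by norm_num) (by norm_num; linarith)

theorem isDominantQuadraticPair_sqrt_seventeen :
    IsDominantQuadraticPair ((1 + √17) / 2) ((1 - √17) / 2) 1 4 := by
  have h2 : 2 < √(17 : ℝ) := Real.lt_sqrt_of_sq_lt (by norm_num)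
  simpa using isDominantQuadraticPair_of_sqrt (a := 1) (b := 4) (Δ := 17) (by norm_num)
    (by norm_num) (by norm_num) (by norm_num; linarith)

theorem cff_golden : CFF ((1 + √5) / 2) := by
  by_contra hc
  obtain ⟨t, k, h⟩ := exists_classical_tail isDominantQuadraticPair_golden hc
  have hβ : √(5 : ℝ) < 3 := (Real.sqrt_lt' (by norm_num)).2 (by norm_num)
  have hk : ∀ n, k n = 1 := by
    intro n
    obtain ⟨-, -, h1, -, h2, h3⟩ := h n
    have := (h (n + 1)).2.2.2.1
    rcases natCast_eq_one_or_two h2 (by linarith) h1 this h3 with h4 | h4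
    · exact h4
    · have : 0 < 1 / t (n + 1) := by positivity
      rw [h4] at h3
      push_cast at h3
      linarith
  have := eq_golden_of_ones (fun n => (h n).2.2.2.1) (fun n => (h n).2.2.1)
    (fun n => by simpa [hk] using (h n).2.2.2.2.2)
  have := (h 0).2.2.1
  linarith

theorem cff_one_add_sqrt_two : CFF (1 + √2) := by
  by_contra hc
  obtain ⟨t, k, h⟩ := exists_classical_tail isDominantQuadraticPair_one_add_sqrt_two hc
  have hβ : √(2 : ℝ) < 3 / 2 := (Real.sqrt_lt' (by norm_num)).2 (by norm_num)
  have hs : √(2 : ℝ) ^ 2 = 2 := Real.sq_sqrt (by norm_num)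
  have hk : ∀ n, k n = 1 := by
    intro n
    obtain ⟨-, -, h1, -, h2, h3⟩ := h n
    obtain ⟨-, -, h5, h6, -, -⟩ := h (n + 1)
    rcases natCast_eq_one_or_two h2 (by linarith) h1 h6 h3 with h4 | h4
    · exact h4
    · rw [h4] at h3
      push_cast at h3
      have h7 : 1 / t (n + 1) < √2 - 1 := by linarith
      rw [div_lt_iff₀ (by linarith)] at h7
      nlinarith [Real.sqrt_nonneg 2]
  have h5 := sqrt_five_mem_of_ones (fun n => (h n).2.2.2.1) (fun n => (h n).2.2.1)
    (fun n => by simpa [hk] using (h n).2.2.2.2.2) (h 0).1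
  exact sqrt_notMem_adjoin isDominantQuadraticPair_one_add_sqrt_two (D := 2) (E := 5) (r := 1)
    (s := 1) (by simp) (by norm_num) (by norm_num) (by norm_num) (by simpa using h5)

theorem cff_sqrt_thirteen : CFF ((1 + √13) / 2) := by
  by_contra hc
  obtain ⟨t, k, h⟩ := exists_classical_tail isDominantQuadraticPair_sqrt_thirteen hc
  have hβ : √(13 : ℝ) < 4 := (Real.sqrt_lt' (by norm_num)).2 (by norm_num)
  have hs : √(13 : ℝ) ^ 2 = 13 := Real.sq_sqrt (by norm_num)
  have hk : ∀ n, k n = 1 := by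
    intro n
    obtain ⟨-, -, h1, -, h2, h3⟩ := h n
    obtain ⟨-, -, h5, h6, -, -⟩ := h (n + 1)
    rcases natCast_eq_one_or_two h2 (by linarith) h1 h6 h3 with h4 | h4
    · exact h4
    · rw [h4] at h3
      push_cast at h3
      have h7 : 1 / t (n + 1) < (√13 - 3) / 2 := by linarith
      rw [div_lt_iff₀ (by linarith)] at h7
      nlinarith [Real.sqrt_nonneg 13]
  have h5 := sqrt_five_mem_of_ones (fun n => (h n).2.2.2.1) (fun n => (h n).2.2.1)
    (fun n => by simpa [hk] using (h n).2.2.2.2.2) (h 0).1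
  exact sqrt_notMem_adjoin isDominantQuadraticPair_sqrt_thirteen (D := 13) (E := 5) (r := 1 / 2)
    (s := 1 / 2) (by push_cast; ring) (by norm_num) (by norm_num) (by norm_num) (by simpa using h5)

theorem cff_sqrt_seventeen : CFF ((1 + √17) / 2) := by
  by_contra hc
  obtain ⟨t, k, h⟩ := exists_classical_tail isDominantQuadraticPair_sqrt_seventeen hc
  have hβ : √(17 : ℝ) < 4.13 := (Real.sqrt_lt' (by norm_num)).2 (by norm_num)
  have hβ' : 4 < √(17 : ℝ) := Real.lt_sqrt_of_sq_lt (by norm_num)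
  have hk : ∀ n, k n = 1 ∨ k n = 2 := fun n =>
    natCast_eq_one_or_two (h n).2.2.2.2.1 (by linarith) (h n).2.2.1 (h (n + 1)).2.2.2.1
      (h n).2.2.2.2.2
  have hsucc : ∀ n, k n = 2 → k (n + 1) = 2 := by
    intro n hn
    refine (hk (n + 1)).resolve_left fun hn1 => ?_
    obtain ⟨-, -, h1, -, -, h3⟩ := h n
    obtain ⟨-, -, -, h6, -, h7⟩ := h (n + 1)
    obtain ⟨-, -, -, h9, h10, h11⟩ := h (n + 2)
    obtain ⟨-, -, h12, h13, -, -⟩ := h (n + 3)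
    rw [hn] at h3
    rw [hn1] at h7
    push_cast at h3 h7
    have h14 : 1 / t (n + 1) < 0.565 := by linarith
    rw [div_lt_iff₀ (by linarith)] at h14
    have h15 : 0.76 < 1 / t (n + 2) := by linarith
    rw [lt_div_iff₀ (by linarith)] at h15
    have h16 : (1 : ℝ) ≤ k (n + 2) := by exact_mod_cast h10
    have h17 : 1 / t (n + 3) < 0.32 := by
      change t (n + 2) = k (n + 2) + 1 / t (n + 3) at h11
      linarith
    rw [div_lt_iff₀ (by linarith)] at h17
    linarith
  by_cases hex : ∃ N, k N = 2
  · obtain ⟨N, hN⟩ := hex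
    have hall : ∀ n, k (N + n) = 2 := by
      intro n
      induction n with
      | zero => exact hN
      | succ n ih => exact hsucc _ ih
    have h2 := eq_one_add_sqrt_two_of_twos (t := fun n => t (N + n)) (fun n => (h _).2.2.2.1)
      (fun n => (h _).2.2.1)
      (fun n => by simpa [hall, Nat.add_assoc] using (h (N + n)).2.2.2.2.2)
    have hmem : √2 ∈ IntermediateField.adjoin ℚ ({(1 + √17) / 2} : Set ℝ) := by
      have h3 := sub_mem (h N).1 (one_mem _)
      have h4 : t N = 1 + √2 := h2
      simpa [h4] using h3
    exact sqrt_notMem_adjoin isDominantQuadraticPair_sqrt_seventeen (D := 17) (E := 2)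
      (r := 1 / 2) (s := 1 / 2) (by push_cast; ring) (by norm_num) (by norm_num) (by norm_num)
      (by simpa using hmem)
  · push Not at hex
    have hall : ∀ n, k n = 1 := fun n => (hk n).resolve_right (hex n)
    have h5 := sqrt_five_mem_of_ones (fun n => (h n).2.2.2.1) (fun n => (h n).2.2.1)
      (fun n => by simpa [hall] using (h n).2.2.2.2.2) (h 0).1
    exact sqrt_notMem_adjoin isDominantQuadraticPair_sqrt_seventeen (D := 17) (E := 5)
      (r := 1 / 2) (s := 1 / 2) (by push_cast; ring) (by norm_num) (by norm_num) (by norm_num)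
      (by simpa using h5)

theorem hasInfiniteExpansion_of_tails {β : ℝ} (hβ : 1 < β) {t : ℕ → ℝ} {a : ℕ → ℕ}
    (ht : ∀ n, 1 < t n) (hlt : ∀ n, t n < β) (hrec : ∀ n, t n = a n + 1 / t (n + 1)) :
    HasInfiniteExpansion (betaIntegers β) (t 0) (fun n => (a n : ℝ)) := by
  have hbd : ∀ n, (a n : ℝ) < t n ∧ t n < a n + 1 := by
    intro n
    have h1 := ht (n + 1)
    have h2 : 0 < 1 / t (n + 1) := by positivity
    have h3 : 1 / t (n + 1) < 1 := by
      rw [div_lt_one (by linarith)]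
      exact h1
    rw [hrec n]
    constructor <;> linarith
  have hfl : ∀ n, mFloor (betaIntegers β) (t n) = a n := fun n =>
    mFloor_betaIntegers_of_lt hβ (hbd n).1.le (hbd n).2 (hlt n)
  have hcq : ∀ n, completeQuotient (betaIntegers β) (t 0) n = t n := by
    intro n
    induction n with
    | zero => rfl
    | succ n ih =>
      rw [completeQuotient, ih, hfl]
      nth_rewrite 1 [hrec n]
      simp
  intro n
  rw [hcq, hfl]
  exact ⟨notMem_betaIntegers_of_lt hβ (hbd n).1 (hbd n).2 (hlt n), rfl⟩

theorem cfDen_bounds {a : ℕ → ℝ} (ha : ∀ n, 1 ≤ a n) : ∀ n : ℕ, (n : ℝ) - 1 ≤ cfDen a n ∧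
    0 ≤ cfDen a n ∧ 1 ≤ cfDen a (n + 1)
  | 0 => by simp [cfDen]
  | 1 => by simpa [cfDen] using ha 1
  | n + 2 => by
    have h1 := cfDen_bounds ha n
    have h2 := cfDen_bounds ha (n + 1)
    have e1 : cfDen a (n + 2) = a (n + 1) * cfDen a (n + 1) + cfDen a n := rfl
    have e2 : cfDen a (n + 3) = a (n + 2) * cfDen a (n + 2) + cfDen a (n + 1) := rfl
    have h3 := ha (n + 1)
    have h4 := ha (n + 2)
    have h5 : (n : ℝ) + 1 ≤ cfDen a (n + 2) := by
      rcases Nat.eq_zero_or_pos n with rfl | hn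
      · simpa using h2.2.2
      · obtain ⟨m, rfl⟩ : ∃ m, n = m + 1 := ⟨n - 1, by omega⟩
        have h6 := (cfDen_bounds ha m).2.2
        have h7 := h2.1
        push_cast at h7 ⊢
        rw [e1]
        nlinarith [h2.2.1]
    refine ⟨by push_cast; linarith, by linarith [h2.2.2], ?_⟩
    change 1 ≤ cfDen a (n + 3)
    rw [e2]
    nlinarith [h2.2.1, h2.2.2]

theorem cfNum_mul_cfDen_sub (a : ℕ → ℝ) (n : ℕ) :
    cfNum a (n + 1) * cfDen a n - cfNum a n * cfDen a (n + 1) = (-1) ^ (n + 1) := by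
  induction n with
  | zero => simp [cfNum, cfDen]
  | succ n ih =>
    rw [cfNum, cfDen, pow_succ, ← ih]
    ring

theorem cfNum_cfDen_tail {a t : ℕ → ℝ} (ht : ∀ n, 1 < t n)
    (hrec : ∀ n, t n = a n + 1 / t (n + 1)) (n : ℕ) :
    t 0 * (cfDen a (n + 1) * t (n + 1) + cfDen a n) =
      cfNum a (n + 1) * t (n + 1) + cfNum a n := by
  have hmul : ∀ n, t n * t (n + 1) = a n * t (n + 1) + 1 := by
    intro n
    have := ht (n + 1)
    rw [hrec n]
    field_simp
  induction n with
  | zero =>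
    have := hmul 0
    simp only [cfNum, cfDen]
    linarith
  | succ n ih =>
    have h1 := ht (n + 2)
    rw [cfNum, cfDen]
    have h2 := hmul (n + 1)
    linear_combination t (n + 2) * ih + (cfNum a (n + 1) - t 0 * cfDen a (n + 1)) * h2

theorem cfConvergesTo_of_tails {a t : ℕ → ℝ} (ht : ∀ n, 1 < t n) (ha : ∀ n, 1 ≤ a n)
    (hrec : ∀ n, t n = a n + 1 / t (n + 1)) : CFConvergesTo a (t 0) := by
  rw [CFConvergesTo, tendsto_iff_dist_tendsto_zero]
  refine squeeze_zero (g := fun n : ℕ => 1 / ((n : ℝ) + 1)) (fun n => dist_nonneg) (fun n => ?_)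
    tendsto_one_div_add_atTop_nhds_zero_nat
  have h1 := cfNum_cfDen_tail ht hrec n
  have h2 := cfNum_mul_cfDen_sub a n
  obtain ⟨-, hd0, hd1⟩ := cfDen_bounds ha n
  have hd2 : (n : ℝ) ≤ cfDen a (n + 1) := by
    have := (cfDen_bounds ha (n + 1)).1
    push_cast at this
    linarith
  have hd3 : (n : ℝ) + 1 ≤ cfDen a (n + 1) * t (n + 1) + cfDen a n := by
    rcases Nat.eq_zero_or_pos n with rfl | hn
    · have := ht 1
      simp [cfDen]
      linarith
    · obtain ⟨m, rfl⟩ : ∃ m, n = m + 1 := ⟨n - 1, by omega⟩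
      have := (cfDen_bounds ha m).2.2
      have := ht (m + 1 + 1)
      nlinarith
  set q := cfDen a (n + 1)
  set r := q * t (n + 1) + cfDen a n with hr
  have hn0 : (0 : ℝ) ≤ n := Nat.cast_nonneg n
  have hr0 : 0 < r := by linarith
  have hq0 : 0 < q := by linarith
  have hdiff : cfNum a (n + 1) / q - t 0 = (-1) ^ (n + 1) / (q * r) := by
    have : t 0 = (cfNum a (n + 1) * t (n + 1) + cfNum a n) / r := by
      rw [eq_div_iff hr0.ne', h1]
    rw [this, div_sub_div _ _ hq0.ne' hr0.ne', ← h2, hr]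
    congr 1
    ring
  rw [Real.dist_eq, hdiff, abs_div, abs_pow, abs_neg, abs_one, one_pow,
    abs_of_pos (mul_pos hq0 hr0)]
  apply one_div_le_one_div_of_le (by linarith)
  nlinarith

theorem cfNum_cfDen_succ (a : ℕ → ℝ) : ∀ n,
    cfNum a (n + 1) = a 0 * cfNum (fun i => a (i + 1)) n + cfDen (fun i => a (i + 1)) n ∧
      cfDen a (n + 1) = cfNum (fun i => a (i + 1)) n
  | 0 => by simp [cfNum, cfDen]
  | 1 => by simp [cfNum, cfDen]; ring
  | n + 2 => by
    obtain ⟨h1, h2⟩ := cfNum_cfDen_succ a n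
    obtain ⟨h3, h4⟩ := cfNum_cfDen_succ a (n + 1)
    constructor
    · change a (n + 2) * cfNum a (n + 2) + cfNum a (n + 1) = _
      rw [h1, h3, cfNum, cfDen]
      ring
    · change a (n + 2) * cfDen a (n + 2) + cfDen a (n + 1) = _
      rw [h2, h4, cfNum]

theorem cfNum_le_three_mul {a : ℕ → ℝ} (h1 : ∀ n, 1 ≤ a n) (h2 : ∀ n, a n ≤ 2) : ∀ n,
    1 ≤ cfNum a (n + 1) ∧ cfNum a (n + 1) ≤ 3 * cfDen a (n + 1)
  | 0 => by
    simp only [cfNum, cfDen]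
    constructor <;> linarith [h1 0, h2 0]
  | 1 => by
    simp only [cfNum, cfDen]
    constructor <;> nlinarith [h1 0, h2 0, h1 1, h2 1]
  | n + 2 => by
    obtain ⟨h3, h4⟩ := cfNum_le_three_mul h1 h2 n
    obtain ⟨h5, h6⟩ := cfNum_le_three_mul h1 h2 (n + 1)
    have e1 : cfNum a (n + 3) = a (n + 2) * cfNum a (n + 2) + cfNum a (n + 1) := rfl
    have e2 : cfDen a (n + 3) = a (n + 2) * cfDen a (n + 2) + cfDen a (n + 1) := rfl
    have h7 := h1 (n + 2)
    change 1 ≤ cfNum a (n + 3) ∧ cfNum a (n + 3) ≤ 3 * cfDen a (n + 3)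
    change 1 ≤ cfNum a (n + 2) at h5
    change cfNum a (n + 2) ≤ 3 * cfDen a (n + 2) at h6
    rw [e1, e2]
    constructor <;> nlinarith

theorem CFConvergesTo.tail {a : ℕ → ℝ} {ξ : ℝ} (h1 : ∀ n, 1 ≤ a n) (h2 : ∀ n, a n ≤ 2)
    (h : CFConvergesTo a ξ) :
    a 0 + 1 / 3 ≤ ξ ∧ CFConvergesTo (fun n => a (n + 1)) (1 / (ξ - a 0)) := by
  set a' : ℕ → ℝ := fun n => a (n + 1) with ha'
  have hb := cfNum_le_three_mul (a := a') (fun n => h1 _) (fun n => h2 _)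
  have hlim : Tendsto (fun n => cfDen a' (n + 1) / cfNum a' (n + 1)) atTop (𝓝 (ξ - a 0)) := by
    have h3 := ((tendsto_add_atTop_iff_nat 1).2 h).sub_const (a 0)
    refine h3.congr fun n => ?_
    obtain ⟨e1, e2⟩ := cfNum_cfDen_succ a (n + 1)
    have h4 : cfNum a' (n + 1) ≠ 0 := by linarith [(hb n).1]
    rw [e1, e2, ← ha', add_div, mul_div_cancel_right₀ _ h4, add_sub_cancel_left]
  have hge : 1 / 3 ≤ ξ - a 0 := by
    refine ge_of_tendsto' hlim fun n => ?_
    rw [div_le_div_iff₀ (by norm_num) (by linarith [(hb n).1])]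
    linarith [(hb n).2]
  refine ⟨by linarith, ?_⟩
  have := hlim.inv₀ (by linarith)
  rw [CFConvergesTo, one_div]
  refine this.congr fun n => ?_
  rw [inv_div]

theorem CFConvergesTo.exists_tails {a : ℕ → ℝ} {ξ : ℝ} (h1 : ∀ n, 1 ≤ a n) (h2 : ∀ n, a n ≤ 2)
    (h : CFConvergesTo a ξ) :
    ∃ t : ℕ → ℝ, t 0 = ξ ∧ (∀ n, 1 < t n) ∧ ∀ n, t n = a n + 1 / t (n + 1) := by
  let t : ℕ → ℝ := fun n => Nat.rec ξ (fun n x => 1 / (x - a n)) n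
  have hs : ∀ n, t (n + 1) = 1 / (t n - a n) := fun n => rfl
  have hc : ∀ n, CFConvergesTo (fun i => a (n + i)) (t n) := by
    intro n
    induction n with
    | zero =>
      simp only [Nat.zero_add]
      exact h
    | succ n ih =>
      have := (ih.tail (fun _ => h1 _) (fun _ => h2 _)).2
      rw [hs]
      simpa [Nat.add_assoc, Nat.add_comm 1] using this
  have hb : ∀ n, a n + 1 / 3 ≤ t n := fun n =>
    ((hc n).tail (fun _ => h1 _) (fun _ => h2 _)).1
  refine ⟨t, rfl, fun n => by linarith [hb n, h1 n], fun n => ?_⟩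
  rw [hs]
  simp

theorem tail_lt_one_add_sqrt_three {t : ℕ → ℝ} {a : ℕ → ℕ} (ht : ∀ n, 1 < t n)
    (hrec : ∀ n, t n = a n + 1 / t (n + 1)) (ha : ∀ n, a n = 1 ∨ a n = 2)
    (hone : ∀ n, ∃ k, a (n + 2 * k) = 1) (n : ℕ) : t n < 1 + √3 := by
  have hs : √(3 : ℝ) ^ 2 = 3 := Real.sq_sqrt (by norm_num)
  have hs1 : 1 < √(3 : ℝ) := Real.lt_sqrt_of_sq_lt (by norm_num)
  have hs2 : √(3 : ℝ) < 2 := (Real.sqrt_lt' (by norm_num)).2 (by norm_num)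
  have hstep : ∀ n, 1 + √3 ≤ t n → 1 + √3 ≤ t (n + 2) := by
    intro n hn
    have e1 := hrec n
    have e2 : t (n + 1) = a (n + 1) + 1 / t (n + 2) := hrec (n + 1)
    have p1 := ht (n + 1)
    have p2 := ht (n + 2)
    have b1 : (a n : ℝ) ≤ 2 := by rcases ha n with h | h <;> rw [h] <;> norm_num
    have b2 : (1 : ℝ) ≤ a (n + 1) := by rcases ha (n + 1) with h | h <;> rw [h] <;> norm_num
    have q1 : √3 - 1 ≤ 1 / t (n + 1) := by linarith
    rw [le_div_iff₀ (by linarith)] at q1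
    have q2 : 1 + 1 / t (n + 2) ≤ t (n + 1) := by linarith
    have q3 : (√3 - 1) * (1 + 1 / t (n + 2)) ≤ 1 :=
      (mul_le_mul_of_nonneg_left q2 (by linarith)).trans q1
    have q4 : (√3 - 1) * (t (n + 2) + 1) ≤ t (n + 2) := by
      have := mul_le_mul_of_nonneg_right q3 (by linarith : 0 ≤ t (n + 2))
      have e3 : (√3 - 1) * (1 + 1 / t (n + 2)) * t (n + 2) = (√3 - 1) * (t (n + 2) + 1) := by
        field_simp
      linarith
    have := mul_le_mul_of_nonneg_left q4 (by linarith : 0 ≤ 2 + √3)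
    nlinarith
  by_contra! hn
  have hall : ∀ k, 1 + √3 ≤ t (n + 2 * k) := by
    intro k
    induction k with
    | zero => exact hn
    | succ k ih => exact hstep _ ih
  obtain ⟨k, hk⟩ := hone n
  have h1 := hall k
  have h2 := ht (n + 2 * k + 1)
  have h3 : 1 / t (n + 2 * k + 1) < 1 := by
    rw [div_lt_one (by linarith)]
    exact h2
  rw [hrec, hk] at h1
  push_cast at h1
  linarith

/-- The continued fraction with partial quotients `l` and last complete quotient `x`. -/
noncomputable def cfFold (l : List ℕ) (x : ℝ) : ℝ := l.foldr (fun a y => (a : ℝ) + 1 / y) x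

/-- The entries of the product of the matrices `!![a, 1; 1, 0]`, for `a` in `l`. -/
def cfMatrix : List ℕ → ℕ × ℕ × ℕ × ℕ
  | [] => (1, 0, 0, 1)
  | a :: l =>
    let m := cfMatrix l
    (a * m.1 + m.2.2.1, a * m.2.1 + m.2.2.2, m.1, m.2.1)

theorem cfFold_pos {x : ℝ} (hx : 0 < x) : ∀ l : List ℕ, 0 < cfFold l x
  | [] => hx
  | a :: l => by
    have := cfFold_pos hx l
    change 0 < (a : ℝ) + 1 / cfFold l x
    positivity

theorem cfFold_mul_eq {x : ℝ} (hx : 0 < x) : ∀ l : List ℕ,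
    0 < (cfMatrix l).1 * x + (cfMatrix l).2.1 ∧
    0 < (cfMatrix l).2.2.1 * x + (cfMatrix l).2.2.2 ∧
    cfFold l x = ((cfMatrix l).1 * x + (cfMatrix l).2.1) /
      ((cfMatrix l).2.2.1 * x + (cfMatrix l).2.2.2)
  | [] => by simp [cfMatrix, cfFold, hx]
  | a :: l => by
    obtain ⟨h1, h2, h3⟩ := cfFold_mul_eq hx l
    have e : cfFold (a :: l) x = (a : ℝ) + 1 / cfFold l x := rfl
    have h4 : (0 : ℝ) ≤ a := Nat.cast_nonneg a
    simp only [cfMatrix]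
    push_cast
    have h5 : 0 < (a * (cfMatrix l).1 + (cfMatrix l).2.2.1 : ℝ) * x +
        (a * (cfMatrix l).2.1 + (cfMatrix l).2.2.2) := by
      nlinarith [mul_nonneg h4 h1.le]
    refine ⟨h5, h1, ?_⟩
    rw [e, h3, one_div_div, eq_div_iff h1.ne', add_mul, div_mul_cancel₀ _ h1.ne']
    ring

theorem isPeriodicBetaCF_of_fixed {β x : ℝ} (hβ : 1 < β) {l : List ℕ}
    (hxK : x ∈ IntermediateField.adjoin ℚ ({β} : Set ℝ)) (hx : 0 < x) (hl : ∀ a ∈ l, 1 ≤ a)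
    (hne : 0 < l.length) (hfix : cfFold l x = x)
    (hbd : ∀ t : ℕ → ℝ, (∀ n, 1 < t n) →
      (∀ n, t n = (l.getD (n % l.length) 0 : ℕ) + 1 / t (n + 1)) → ∀ n, t n < β) :
    IsPeriodicBetaCF β x l := by
  set t : ℕ → ℝ := fun n => cfFold (l.drop (n % l.length)) x with ht
  have ht0 : t 0 = x := by simpa [ht] using hfix
  have hrec : ∀ n, t n = (l.getD (n % l.length) 0 : ℕ) + 1 / t (n + 1) := by
    intro n
    have hlt := Nat.mod_lt n hne
    have hdrop := List.drop_eq_getElem_cons hlt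
    have e1 : t n = (l[n % l.length] : ℝ) + 1 / cfFold (l.drop (n % l.length + 1)) x := by
      simp only [ht]
      rw [hdrop]
      rfl
    rw [e1, List.getD_eq_getElem _ _ hlt]
    congr 2
    rcases Nat.lt_or_ge (n % l.length + 1) l.length with h | h
    · simp only [ht]
      rw [Nat.add_mod n 1, Nat.mod_eq_of_lt (show 1 < l.length by omega), Nat.mod_eq_of_lt h]
    · have h0 : (n + 1) % l.length = 0 := by
        refine Nat.mod_eq_zero_of_dvd ⟨n / l.length + 1, ?_⟩
        have := Nat.div_add_mod n l.length
        rw [mul_add, mul_one]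
        linarith
      simp only [ht]
      rw [h0, List.drop_of_length_le h, List.drop_zero, hfix]
      rfl
  have hmem : ∀ n, 1 ≤ l.getD (n % l.length) 0 := by
    intro n
    rw [List.getD_eq_getElem _ _ (Nat.mod_lt n hne)]
    exact hl _ (List.getElem_mem _)
  have hmem' : ∀ n, (1 : ℝ) ≤ (l.getD (n % l.length) 0 : ℕ) := fun n => by
    exact_mod_cast hmem n
  have hpos : ∀ n, 1 < t n := by
    intro n
    have h1 : 0 < 1 / t (n + 1) := one_div_pos.2 (cfFold_pos hx _)
    rw [hrec]
    linarith [hmem' n]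
  refine ⟨hxK, ?_, ?_⟩
  · rw [← ht0]
    exact cfConvergesTo_of_tails hpos hmem' hrec
  · rw [← ht0]
    exact hasInfiniteExpansion_of_tails hβ hpos (hbd t hpos hrec) hrec

theorem isPeriodicBetaCF_of_ones_and_twos {β x : ℝ} (hβ : 1 + √3 ≤ β) {l : List ℕ} {m : ℕ}
    (hxK : x ∈ IntermediateField.adjoin ℚ ({β} : Set ℝ)) (hx : 0 < x)
    (hl : ∀ a ∈ l, a = 1 ∨ a = 2) (hlen : l.length = 2 * (m + 1)) (h0 : l.getD 0 0 = 1)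
    (h1 : l.getD 1 0 = 1) (hfix : cfFold l x = x) : IsPeriodicBetaCF β x l := by
  have hs1 : 1 < √(3 : ℝ) := Real.lt_sqrt_of_sq_lt (by norm_num)
  refine isPeriodicBetaCF_of_fixed (by linarith) hxK hx
    (fun a ha => by rcases hl a ha with h | h <;> omega) (by omega) hfix fun t ht hrec n => ?_
  refine (tail_lt_one_add_sqrt_three ht hrec ?_ ?_ n).trans_le hβ
  · intro n
    rw [List.getD_eq_getElem _ _ (Nat.mod_lt n (by omega))]
    exact hl _ (List.getElem_mem _)
  · intro n
    rcases Nat.even_or_odd' n with ⟨j, rfl | rfl⟩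
    · refine ⟨m * j, ?_⟩
      rw [hlen, show 2 * j + 2 * (m * j) = 2 * (m + 1) * j by ring, Nat.mul_mod_right, h0]
    · refine ⟨m * j, ?_⟩
      rw [hlen, show 2 * j + 1 + 2 * (m * j) = 1 + 2 * (m + 1) * j by ring,
        Nat.add_mul_mod_self_left, Nat.mod_eq_of_lt (by omega), h1]

theorem not_cff_of_hasInfiniteExpansion {β ξ : ℝ} {a : ℕ → ℝ}
    (hξ : ξ ∈ IntermediateField.adjoin ℚ ({β} : Set ℝ))
    (h : HasInfiniteExpansion (betaIntegers β) ξ a) : ¬ CFF β := fun hc => by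
  obtain ⟨n, hn⟩ := hc ξ hξ
  exact (h n).1 hn

theorem rat_add_mul_mem_adjoin (β : ℝ) (r s : ℚ) :
    (r + s * β : ℝ) ∈ IntermediateField.adjoin ℚ ({β} : Set ℝ) :=
  add_mem (SubfieldClass.ratCast_mem _ _) (mul_mem (SubfieldClass.ratCast_mem _ _)
    (IntermediateField.mem_adjoin_simple_self ℚ β))

theorem isPeriodicBetaCF_golden_sq : IsPeriodicBetaCF ((3 + √5) / 2) ((1 + √5) / 2) [1] := by
  have h2 : 2 < √(5 : ℝ) := Real.lt_sqrt_of_sq_lt (by norm_num)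
  have hs : √(5 : ℝ) ^ 2 = 5 := Real.sq_sqrt (by norm_num)
  refine isPeriodicBetaCF_of_fixed (by linarith) ?_ (by positivity) (by simp) (by simp) ?_ ?_
  · convert rat_add_mul_mem_adjoin ((3 + √5) / 2) (-1) 1 using 1
    push_cast
    ring
  · rw [(cfFold_mul_eq (by positivity) _).2.2]
    simp [cfMatrix]
    field_simp
    linarith
  · intro t ht hrec n
    have h1 := ht (n + 1)
    have h3 : 1 / t (n + 1) < 1 := by
      rw [div_lt_one (by linarith)]
      exact h1
    rw [hrec]
    simp [Nat.mod_one] at h3 ⊢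
    linarith

theorem isPeriodicBetaCF_one_add_sqrt_three :
    IsPeriodicBetaCF (1 + √3) ((11055 + 10864 * √3) / 18471)
      [1, 1, 1, 1, 1, 1, 1, 2, 1, 1, 2, 1, 2, 1, 1, 1, 2, 2] := by
  have hs : √(3 : ℝ) ^ 2 = 3 := Real.sq_sqrt (by norm_num)
  refine isPeriodicBetaCF_of_ones_and_twos (m := 8) le_rfl ?_ (by positivity) (by simp) rfl rfl rfl
    ?_
  · convert rat_add_mul_mem_adjoin (1 + √3) ((11055 - 10864) / 18471) (10864 / 18471) using 1
    push_cast
    ring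
  · obtain ⟨-, h1, h2⟩ := cfFold_mul_eq (x := (11055 + 10864 * √3) / 18471) (by positivity)
      [1, 1, 1, 1, 1, 1, 1, 2, 1, 1, 2, 1, 2, 1, 1, 1, 2, 2]
    rw [h2, div_eq_iff h1.ne']
    simp [cfMatrix]
    linarith

theorem isPeriodicBetaCF_sqrt_twentyone :
    IsPeriodicBetaCF ((1 + √21) / 2) ((117 + 44 * √21) / 202)
      [1, 1, 1, 2, 1, 2, 1, 2, 2, 2, 1, 1, 2, 2] := by
  have hs : √(21 : ℝ) ^ 2 = 21 := Real.sq_sqrt (by norm_num)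
  have h1 : 4.5 < √(21 : ℝ) := Real.lt_sqrt_of_sq_lt (by norm_num)
  have h2 : √(3 : ℝ) < 1.74 := (Real.sqrt_lt' (by norm_num)).2 (by norm_num)
  refine isPeriodicBetaCF_of_ones_and_twos (m := 6) (by linarith) ?_ (by positivity) (by simp) rfl
    rfl rfl ?_
  · convert rat_add_mul_mem_adjoin ((1 + √21) / 2) ((117 - 44) / 202) (88 / 202) using 1
    push_cast
    ring
  · obtain ⟨-, h1, h2⟩ := cfFold_mul_eq (x := (117 + 44 * √21) / 202) (by positivity)
      [1, 1, 1, 2, 1, 2, 1, 2, 2, 2, 1, 1, 2, 2]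
    rw [h2, div_eq_iff h1.ne']
    simp [cfMatrix]
    linarith

theorem isDominantQuadraticPair_of_isQuadraticPerron {β : ℝ} (h : IsQuadraticPerron β) :
    ∃ a b : ℤ, IsDominantQuadraticPair β (a - β) a b := by
  obtain ⟨⟨h1, hint, hroots⟩, hdeg⟩ := h
  have hmap := minpoly.isIntegrallyClosed_eq_field_fractions' ℚ hint
  have hmonic := minpoly.monic hint
  have hintQ : IsIntegral ℚ β := hint.tower_top
  have hdegZ : (minpoly ℤ β).natDegree = 2 := by
    rw [← hdeg, hmap, hmonic.natDegree_map]
  have hsum := hmonic.as_sum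
  rw [hdegZ, Finset.sum_range_succ, Finset.sum_range_one] at hsum
  set c₀ := (minpoly ℤ β).coeff 0
  set c₁ := (minpoly ℤ β).coeff 1
  have hβ : β ^ 2 + (c₀ + c₁ * β) = 0 := by
    have := minpoly.aeval ℤ β
    rw [hsum] at this
    simpa using this
  have hirr : Irrational β := by
    rintro ⟨r, hr⟩
    have : (minpoly ℚ β).natDegree = 1 := minpoly.natDegree_eq_one_iff.2 ⟨r, by simpa using hr⟩
    omega
  have hconj : ‖(((-c₁ : ℤ) - β : ℝ) : ℂ)‖ < β := by
    refine hroots _ ?_ ?_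
    · rw [Polynomial.mem_aroots]
      refine ⟨minpoly.ne_zero hintQ, ?_⟩
      rw [hmap, Polynomial.aeval_map_algebraMap, hsum]
      have hreal : ((-c₁ : ℤ) - β : ℝ) ^ 2 + (c₀ + c₁ * ((-c₁ : ℤ) - β : ℝ)) = 0 := by
        push_cast
        linear_combination hβ
      have := congrArg (fun x : ℝ => (x : ℂ)) hreal
      simpa using this
    · intro he
      have he' : ((-c₁ : ℤ) - β : ℝ) = β := by exact_mod_cast he
      refine hirr ⟨-c₁ / 2, ?_⟩
      push_cast at he' ⊢
      linarith
  rw [Complex.norm_real, Real.norm_eq_abs] at hconj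
  refine ⟨-c₁, -c₀, h1, hirr, ?_, rfl, hconj⟩
  push_cast
  linear_combination hβ

theorem IsDominantQuadraticPair.isQuadraticPerron {β β' : ℝ} {a b : ℤ}
    (h : IsDominantQuadraticPair β β' a b) : IsQuadraticPerron β := by
  set p : Polynomial ℤ := Polynomial.X ^ 2 +
    (-Polynomial.C a * Polynomial.X - Polynomial.C b) with hp
  have hdegZ : p.natDegree = 2 := by
    rw [hp]
    compute_degree!
  have hmonic : p.Monic := by
    apply Polynomial.monic_X_pow_add
    compute_degree!
  have haeval : Polynomial.aeval β p = 0 := by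
    simp [hp]
    linarith [h.sq_eq]
  have hint : IsIntegral ℤ β := ⟨p, hmonic, by rwa [← Polynomial.aeval_def]⟩
  have hintQ : IsIntegral ℚ β := hint.tower_top
  have htwo : 2 ≤ (minpoly ℚ β).natDegree := by
    rw [minpoly.two_le_natDegree_iff hintQ]
    rintro ⟨r, hr⟩
    exact h.irrational ⟨r, by simpa using hr⟩
  have hmin : p.map (algebraMap ℤ ℚ) = minpoly ℚ β := by
    refine Polynomial.eq_of_monic_of_dvd_of_natDegree_le (minpoly.monic hintQ) (hmonic.map _) ?_ ?_
    · apply minpoly.dvd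
      rwa [Polynomial.aeval_map_algebraMap]
    · rwa [hmonic.natDegree_map, hdegZ]
  refine ⟨⟨h.one_lt, hint, ?_⟩, by rw [← hmin, hmonic.natDegree_map, hdegZ]⟩
  intro z hz hne
  rw [Polynomial.mem_aroots, ← hmin, Polynomial.aeval_map_algebraMap] at hz
  have hz2 : z ^ 2 + (-((a : ℂ) * z) - b) = 0 := by simpa [hp] using hz.2
  have hβ2 : (β : ℂ) ^ 2 = a * β + b := by exact_mod_cast h.sq_eq
  have hfac : (z - β) * (z - (a - β)) = 0 := by linear_combination hz2 - hβ2
  have hzβ : z = ((β' : ℝ) : ℂ) := by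
    rw [h.conj_eq]
    push_cast
    exact sub_eq_zero.1 ((mul_eq_zero.1 hfac).resolve_left (sub_ne_zero.2 hne))
  rw [hzβ, Complex.norm_real, Real.norm_eq_abs]
  exact h.abs_conj_lt

theorem isDominantQuadraticPair_golden_sq :
    IsDominantQuadraticPair ((3 + √5) / 2) ((3 - √5) / 2) 3 (-1) := by
  have h2 : 2 < √(5 : ℝ) := Real.lt_sqrt_of_sq_lt (by norm_num)
  simpa using isDominantQuadraticPair_of_sqrt (a := 3) (b := -1) (Δ := 5) (by norm_num)
    (by norm_num) (by norm_num) (by norm_num; linarith)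

theorem isDominantQuadraticPair_one_add_sqrt_three :
    IsDominantQuadraticPair (1 + √3) (1 - √3) 2 2 := by
  have h2 : 0 < √(3 : ℝ) := by positivity
  have h := isDominantQuadraticPair_of_sqrt (a := 2) (b := 2) (Δ := 12) (by norm_num)
    (by norm_num) (by norm_num) (by push_cast; rw [sqrt_twelve]; linarith)
  push_cast at h
  rw [sqrt_twelve] at h
  convert h using 1 <;> ring

theorem isDominantQuadraticPair_sqrt_twentyone :
    IsDominantQuadraticPair ((1 + √21) / 2) ((1 - √21) / 2) 1 5 := by
  have h2 : 2 < √(21 : ℝ) := Real.lt_sqrt_of_sq_lt (by norm_num)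
  simpa using isDominantQuadraticPair_of_sqrt (a := 1) (b := 5) (Δ := 21) (by norm_num)
    (by norm_num) (by norm_num) (by norm_num; linarith)

theorem IsDominantQuadraticPair.eq_sqrt {β β' : ℝ} {a b : ℤ}
    (h : IsDominantQuadraticPair β β' a b) : β = (a + √((a : ℝ) ^ 2 + 4 * b)) / 2 := by
  have h1 : 0 ≤ 2 * β - a := by
    have := h.conj_lt
    rw [h.conj_eq] at this
    linarith
  have h2 : (a : ℝ) ^ 2 + 4 * b = (2 * β - a) ^ 2 := by linear_combination (-4) * h.sq_eq
  rw [h2, Real.sqrt_sq h1]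
  ring

theorem IsDominantQuadraticPair.ne_two {β β' : ℝ} {a b : ℤ}
    (h : IsDominantQuadraticPair β β' a b) : β ≠ 2 := fun h2 =>
  h.irrational ⟨2, by simp [h2]⟩

theorem IsDominantQuadraticPair.eq_of_lt_three {β β' : ℝ} {a b : ℤ}
    (h : IsDominantQuadraticPair β β' a b) (h3 : β < 3) :
    β = (1 + √5) / 2 ∨ β = 1 + √2 ∨ β = (1 + √13) / 2 ∨ β = (1 + √17) / 2 ∨
      β = (3 + √5) / 2 ∨ β = 1 + √3 ∨ β = (1 + √21) / 2 := by
  have h1 := h.one_lt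
  have hne := h.ne_two
  have hsq := h.sq_eq
  have hroot := h.eq_sqrt
  obtain ⟨hl, hu⟩ := abs_lt.1 h.abs_conj_lt
  rw [h.conj_eq] at hl hu
  have ha0 : 0 < a := by
    have : (0 : ℝ) < a := by linarith
    exact_mod_cast this
  have ha6 : a < 6 := by
    have : (a : ℝ) < 6 := by linarith
    exact_mod_cast this
  have hb : (b : ℝ) = β ^ 2 - a * β := by linarith
  interval_cases a
  · push_cast at *
    have hb0 : 0 < b := by
      have : (0 : ℝ) < b := by nlinarith
      exact_mod_cast this
    have hb6 : b < 6 := by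
      have : (b : ℝ) < 6 := by nlinarith
      exact_mod_cast this
    interval_cases b <;> norm_num at hroot
    · exact Or.inl hroot
    · exfalso
      apply hne
      have : (β - 2) * (β + 1) = 0 := by push_cast at hsq; linarith
      rcases mul_eq_zero.1 this with h | h <;> linarith
    · tauto
    · tauto
    · tauto
  · push_cast at *
    have hb0 : -1 < b := by
      have : (-1 : ℝ) < b := by nlinarith
      exact_mod_cast this
    have hb3 : b < 3 := by
      have : (b : ℝ) < 3 := by nlinarith
      exact_mod_cast this
    interval_cases b <;> norm_num at hroot
    · exfalso
      apply hne
      have : (β - 2) * β = 0 := by push_cast at hsq; linarith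
      rcases mul_eq_zero.1 this with h | h <;> linarith
    · rw [sqrt_eight] at hroot
      right; left
      linarith
    · rw [sqrt_twelve] at hroot
      right; right; right; right; right; left
      linarith
  · push_cast at *
    have hb0 : -3 < b := by
      have : (-3 : ℝ) < b := by nlinarith [sq_nonneg (2 * β - 3)]
      exact_mod_cast this
    have hb3 : b < 0 := by
      have : (b : ℝ) < 0 := by nlinarith
      exact_mod_cast this
    interval_cases b <;> norm_num at hroot
    · exfalso
      apply hne
      have : (β - 2) * (β - 1) = 0 := by push_cast at hsq; linarith
      rcases mul_eq_zero.1 this with h | h <;> linarith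
    · tauto
  · push_cast at *
    have hb0 : -4 < b := by
      have : (-4 : ℝ) < b := by nlinarith
      exact_mod_cast this
    have hb3 : b < -3 := by
      have : (b : ℝ) < -3 := by nlinarith
      exact_mod_cast this
    omega
  · push_cast at *
    have hb0 : -7 < b := by
      have : (-7 : ℝ) < b := by nlinarith [sq_nonneg (2 * β - 5)]
      exact_mod_cast this
    have hb3 : b < -6 := by
      have : (b : ℝ) < -6 := by nlinarith
      exact_mod_cast this
    omega

theorem MercatConjecture.not_cff (hM : MercatConjecture) {β : ℝ} (h : IsQuadraticPerron β)
    (h3 : 3 ≤ β) : ¬ CFF β := by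
  have hrank : Module.finrank ℚ (IntermediateField.adjoin ℚ ({β} : Set ℝ)) = 2 := by
    rw [IntermediateField.adjoin.finrank h.1.2.1.tower_top, h.2]
  obtain ⟨ξ, hξ, a, ha, -, hconv⟩ := hM _ hrank
  have ha1 : ∀ n, (1 : ℝ) ≤ a n := fun n => by rcases ha n with h | h <;> rw [h] <;> norm_num
  have ha2 : ∀ n, (a n : ℝ) ≤ 2 := fun n => by rcases ha n with h | h <;> rw [h] <;> norm_num
  obtain ⟨t, rfl, ht, hrec⟩ := hconv.exists_tails ha1 ha2
  refine not_cff_of_hasInfiniteExpansion hξ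
    (hasInfiniteExpansion_of_tails (by linarith) ht (fun n => ?_) hrec)
  have h1 := ht (n + 1)
  have h2 : 1 / t (n + 1) < 1 := by
    rw [div_lt_one (by linarith)]
    exact h1
  rw [hrec]
  linarith [ha2 n]

theorem mainTheorem4 :
    -- the quadratic Perron numbers smaller than 3
    {β : ℝ | IsQuadraticPerron β ∧ β < 3} =
      {(1 + √5) / 2, 1 + √2, (1 + √13) / 2, (1 + √17) / 2,
        (3 + √5) / 2, 1 + √3, (1 + √21) / 2} ∧
    -- exactly four of them have property (CFF)
    {β : ℝ | IsQuadraticPerron β ∧ β < 3 ∧ CFF β} =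
      {(1 + √5) / 2, 1 + √2, (1 + √13) / 2, (1 + √17) / 2} ∧
    -- the other three fail it, with explicit periodic expansions
    (¬ CFF ((3 + √5) / 2) ∧ IsPeriodicBetaCF ((3 + √5) / 2) ((1 + √5) / 2) [1]) ∧
    (¬ CFF (1 + √3) ∧ IsPeriodicBetaCF (1 + √3) ((11055 + 10864 * √3) / 18471)
      [1, 1, 1, 1, 1, 1, 1, 2, 1, 1, 2, 1, 2, 1, 1, 1, 2, 2]) ∧
    (¬ CFF ((1 + √21) / 2) ∧ IsPeriodicBetaCF ((1 + √21) / 2) ((117 + 44 * √21) / 202)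
      [1, 1, 1, 2, 1, 2, 1, 2, 2, 2, 1, 1, 2, 2]) ∧
    -- the conditional statement
    (MercatConjecture →
      {β : ℝ | IsQuadraticPerron β ∧ CFF β} =
        {(1 + √5) / 2, 1 + √2, (1 + √13) / 2, (1 + √17) / 2}) := by
  have b2 : √(2 : ℝ) < 2 := (Real.sqrt_lt' (by norm_num)).2 (by norm_num)
  have b3 : √(3 : ℝ) < 2 := (Real.sqrt_lt' (by norm_num)).2 (by norm_num)
  have b5 : √(5 : ℝ) < 3 := (Real.sqrt_lt' (by norm_num)).2 (by norm_num)
  have b13 : √(13 : ℝ) < 5 := (Real.sqrt_lt' (by norm_num)).2 (by norm_num)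
  have b17 : √(17 : ℝ) < 5 := (Real.sqrt_lt' (by norm_num)).2 (by norm_num)
  have b21 : √(21 : ℝ) < 5 := (Real.sqrt_lt' (by norm_num)).2 (by norm_num)
  have hP5 := isPeriodicBetaCF_golden_sq
  have hP3 := isPeriodicBetaCF_one_add_sqrt_three
  have hP21 := isPeriodicBetaCF_sqrt_twentyone
  have n5 := not_cff_of_hasInfiniteExpansion hP5.1 hP5.2.2
  have n3 := not_cff_of_hasInfiniteExpansion hP3.1 hP3.2.2
  have n21 := not_cff_of_hasInfiniteExpansion hP21.1 hP21.2.2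
  have hfour : ∀ β : ℝ, IsQuadraticPerron β ∧ β < 3 ∧ CFF β ↔
      β ∈ ({(1 + √5) / 2, 1 + √2, (1 + √13) / 2, (1 + √17) / 2} : Set ℝ) := by
    intro β
    simp only [Set.mem_insert_iff, Set.mem_singleton_iff]
    constructor
    · rintro ⟨hβ, hlt, hc⟩
      obtain ⟨a, b, h⟩ := isDominantQuadraticPair_of_isQuadraticPerron hβ
      rcases h.eq_of_lt_three hlt with h | h | h | h | h | h | h
      · exact Or.inl h
      · exact Or.inr (Or.inl h)
      · exact Or.inr (Or.inr (Or.inl h))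
      · exact Or.inr (Or.inr (Or.inr h))
      · exact absurd (h ▸ hc) n5
      · exact absurd (h ▸ hc) n3
      · exact absurd (h ▸ hc) n21
    · rintro (rfl | rfl | rfl | rfl)
      · exact ⟨isDominantQuadraticPair_golden.isQuadraticPerron, by linarith, cff_golden⟩
      · exact ⟨isDominantQuadraticPair_one_add_sqrt_two.isQuadraticPerron, by linarith,
          cff_one_add_sqrt_two⟩
      · exact ⟨isDominantQuadraticPair_sqrt_thirteen.isQuadraticPerron, by linarith,
          cff_sqrt_thirteen⟩
      · exact ⟨isDominantQuadraticPair_sqrt_seventeen.isQuadraticPerron, by linarith,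
          cff_sqrt_seventeen⟩
  refine ⟨?_, Set.ext hfour, ⟨n5, hP5⟩, ⟨n3, hP3⟩, ⟨n21, hP21⟩, fun hM => Set.ext fun β => ?_⟩
  · ext β
    constructor
    · rintro ⟨hβ, hlt⟩
      obtain ⟨a, b, h⟩ := isDominantQuadraticPair_of_isQuadraticPerron hβ
      exact h.eq_of_lt_three hlt
    · rintro (rfl | rfl | rfl | rfl | rfl | rfl | rfl)
      · exact ⟨isDominantQuadraticPair_golden.isQuadraticPerron, by linarith⟩
      · exact ⟨isDominantQuadraticPair_one_add_sqrt_two.isQuadraticPerron, by linarith⟩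
      · exact ⟨isDominantQuadraticPair_sqrt_thirteen.isQuadraticPerron, by linarith⟩
      · exact ⟨isDominantQuadraticPair_sqrt_seventeen.isQuadraticPerron, by linarith⟩
      · exact ⟨isDominantQuadraticPair_golden_sq.isQuadraticPerron, by linarith⟩
      · exact ⟨isDominantQuadraticPair_one_add_sqrt_three.isQuadraticPerron, by linarith⟩
      · exact ⟨isDominantQuadraticPair_sqrt_twentyone.isQuadraticPerron, by linarith⟩
  · rw [← hfour β]
    refine ⟨fun ⟨hβ, hc⟩ => ⟨hβ, ?_, hc⟩, fun ⟨hβ, _, hc⟩ => ⟨hβ, hc⟩⟩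
    by_contra! h3
    exact hM.not_cff hβ h3 hc
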